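/- **Conventions.** Let $X$ be a topological space with lattice $\mathcal O X$ of open sets. A *continuous valuation* on $X$ is a map $\nu\colon\mathcal O X\to[0,\infty]$ with $\nu(\emptyset)=0$ and $\nu(U)+\nu(V)=\nu(U\cup V)+\nu(U\cap V)$ that is Scott-continuous (monotonic and preserving directed suprema). $\mathbf V X$ is the set of continuous valuations on $X$ with pointwise addition and multiplication by scalars $a\ge 0$ ($0\cdot\infty=0$), the stochastic ordering ($\mu\le\nu$ iff $\mu(U)\le\nu(U)$ for all open $U$), and the weak topology, with subbasic open sets $\{\nu\mid\nu(U)>r\}$, $U$ open, $r>0$. Subsets of $\mathbf V X$ carry the subspace topology. $\nu$ is *bounded* if $\nu(X)<\infty$; *simple* if $\nu=\sum_{i=1}^n a_i\delta_{x_i}$ with $a_i\in[0,\infty)$, $x_i\in X$; *point-continuous* if it is continuous from $\mathcal O X$ with the topology generated by the sets $\{U\mid x\in U\}$, $x\in X$, to $[0,\infty]$ with its Scott topology. $\mathbf V_b X$, $\mathbf V_{fin}X$, $\mathbf V_{pw}X$ are the sets of bounded, simple and point-continuous valuations. A subscript $\le 1$ (resp. $1$) means in addition $\nu(X)\le 1$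 (resp. $\nu(X)=1$). A *crescent* is a set $C=U\smallsetminus V$ with $U,V$ open; the *constriction* of a bounded $\nu\in\mathbf V X$ to $C$ is $\nu_{|C}(W)=\nu(W\cap C):=\nu((W\cap U)\cup V)-\nu(V)$, $W$ open. A *cone* is a commutative monoid with an action of the semiring $\mathbb R_+$; it is *topological* if it has a topology making addition and scalar multiplication jointly continuous, $\mathbb R_+$ having its Scott topology. A *barycentric algebra* is a set with operations $+_a$, $a\in[0,1]$, such that $x+_1y=x$, $x+_ax=x$, $x+_ay=y+_{1-a}x$, and $(x+_ay)+_bz=x+_{ab}(y+_{(1-a)b/(1-ab)}z)$ for $a,b<1$. Every convex subset of a cone is one, with $x+_ay=a\cdot x+(1-a)\cdot y$. A barycentric algebra $\mathcal B$ with a topology is *topological* if $(x,a,y)\mapsto x+_ay$ is jointly continuous on $\mathcal B\times[0,1]\times\mathcal B$, where $[0,1]$ has its usual topology. For $A\subseteq\mathcal B$, $\uparrow A$ is the upward closure of $A$ in $\mathcal B$ in the specialization preordering ($x\le y$ iff every open neighborhood of $x$ contains $y$). $\mathcal B$ is *consistent* if $\uparrow\{x+_ay\mid x\in U,y\in V,a\in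 I\}$ is open for all open $U,V\subseteq\mathcal B$ and every open $I\subseteq[0,1]$; it is *strongly consistent* if $\uparrow\{x+_ay\mid x\in U,y\in V\}$ is open for all open $U,V\subseteq\mathcal B$ and every $a\in[0,1]$. A topological cone is called consistent if it is so as a barycentric algebra. **Theorem.** Let $X$ be a topological space, let $\mathcal B$ be a convex subset of $\mathbf V X$, and let $\mathcal B_b$ be the set of bounded elements of $\mathcal B$. Assume that (i) every element of $\mathcal B$ is the supremum in $\mathbf V X$ of a (non-empty) directed family of elements of $\mathcal B_b$; (ii) for all $\mu\in\mathcal B_b$ and $c\in(0,1)$, $c\cdot\mu\in\mathcal B$; (iii) for all $\mu,\varpi\in\mathcal B_b$ and every $r>1$, every finite linear combination $\mu'$, with coefficients in $[0,\infty)$, of constrictions of $r\cdot\varpi$ to pairwise disjoint crescents such that $\mu(X)=\mu'(X)$ is in $\mathcal B$. Then $\mathcal B$ is a strongly consistent topological barycentric algebra. In particular, for every topological space $X$: 1. $\mathbf V X$, $\mathbf V_bX$, $\mathbf V_{pw}X$ and $\mathbf V_{fin}X$ are consistent topological cones; 2. $\mathbf V_{\le1}X$, $\mathbf V_{\le1,pw}X$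 and $\mathbf V_{\le1,fin}X$ are strongly consistent topological barycentric algebras; 3. if $X$ is pointed, that is, has a least element in its specialization preordering, then $\mathbf V_1X$, $\mathbf V_{1,pw}X$ and $\mathbf V_{1,fin}X$ are strongly consistent topological barycentric algebras. -/

import Mathlib

open TopologicalSpace Topology Set
open scoped NNReal ENNReal unitInterval

/-! ### Barycentric algebras and cones

A cone is a commutative monoid with an action of the semiring of non-negative reals, that is, a
`Module ℝ≥0 C` over an `AddCommMonoid C`. -/

/-- A barycentric algebra: `bary a x y` is `x +_a y`. -/
class BarycentricAlgebra (B : Type*) where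
  bary : I → B → B → B
  bary_one : ∀ x y : B, bary 1 x y = x
  bary_self : ∀ (a : I) (x : B), bary a x x = x
  bary_symm : ∀ (a : I) (x y : B), bary a x y = bary (σ a) y x
  bary_assoc : ∀ (a b c : I) (x y z : B), a < 1 → b < 1 →
    (c : ℝ) = (1 - (a : ℝ)) * b / (1 - (a : ℝ) * b) →
    bary b (bary a x y) z = bary (a * b) x (bary c y z)

open BarycentricAlgebra

/-- A topological barycentric algebra: `(x, a, y) ↦ x +_a y` is jointly continuous, where `[0, 1]`
has its usual topology. -/
def IsTopologicalBarycentricAlgebra (B : Type*) [BarycentricAlgebra B] [TopologicalSpace B] :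
    Prop :=
  Continuous fun p : B × I × B => bary p.2.1 p.1 p.2.2

/-- The upward closure `↑A` of `A` in the specialization preordering, in which `x ≤ y` means that
every open neighborhood of `x` contains `y` (in Mathlib's notation, `y ⤳ x`). -/
def upClosure {B : Type*} [TopologicalSpace B] (A : Set B) : Set B :=
  {y | ∃ x ∈ A, y ⤳ x}

/-- Consistency: `↑(U +_J V)` is open for all open `U`, `V` and every open `J ⊆ [0, 1]`. -/
def IsConsistent (B : Type*) [BarycentricAlgebra B] [TopologicalSpace B] : Prop :=
  ∀ (U V : Set B) (J : Set I), IsOpen U → IsOpen V → IsOpen J →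
    IsOpen (upClosure {z | ∃ a ∈ J, ∃ x ∈ U, ∃ y ∈ V, bary a x y = z})

/-- Strong consistency: `↑(U +_a V)` is open for all open `U`, `V` and every `a ∈ [0, 1]`. -/
def IsStronglyConsistent (B : Type*) [BarycentricAlgebra B] [TopologicalSpace B] : Prop :=
  ∀ (U V : Set B) (a : I), IsOpen U → IsOpen V →
    IsOpen (upClosure {z | ∃ x ∈ U, ∃ y ∈ V, bary a x y = z})

section Cones

variable {C : Type*} [AddCommMonoid C] [Module ℝ≥0 C]

/-- Every cone is a barycentric algebra, with `x +_a y = a • x + (1 - a) • y`. -/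
@[reducible] def BarycentricAlgebra.ofCone (C : Type*) [AddCommMonoid C] [Module ℝ≥0 C] :
    BarycentricAlgebra C where
  bary a x y := unitInterval.toNNReal a • x + unitInterval.toNNReal (σ a) • y
  bary_one x y := by simp
  bary_self a x := by rw [← add_smul, unitInterval.toNNReal_add_toNNReal_symm, one_smul]
  bary_symm a x y := by rw [unitInterval.symm_symm, add_comm]
  bary_assoc a b c x y z ha hb hc := by
    have hab : (0 : ℝ) < 1 - (a : ℝ) * b := by
      have h1 : (a : ℝ) < 1 := ha
      have h2 : (b : ℝ) < 1 := hb
      nlinarith [a.2.1, b.2.1]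
    have hc' : (1 - (a : ℝ) * b) * c = (1 - (a : ℝ)) * b := by
      rw [hc]; field_simp
    have e1 : unitInterval.toNNReal (a * b) = unitInterval.toNNReal b * unitInterval.toNNReal a := by
      
      apply NNReal.eq
      simp only [NNReal.coe_mul, unitInterval.coe_toNNReal, Icc.coe_mul]
      ring
    have e2 : unitInterval.toNNReal (σ (a * b)) * unitInterval.toNNReal c
        = unitInterval.toNNReal b * unitInterval.toNNReal (σ a) := by
      apply NNReal.eq
      simp only [NNReal.coe_mul, unitInterval.coe_toNNReal, unitInterval.coe_symm_eq,
        Icc.coe_mul]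
      linarith
    have e3 : unitInterval.toNNReal (σ (a * b)) * unitInterval.toNNReal (σ c)
        = unitInterval.toNNReal (σ b) := by
      apply NNReal.eq
      simp only [NNReal.coe_mul, unitInterval.coe_toNNReal, unitInterval.coe_symm_eq,
        Icc.coe_mul]
      linarith
    simp only [smul_add, smul_smul, e1, e2, e3, add_assoc]

/-- Every convex subset of a cone is a barycentric algebra, with the induced operations. -/
@[reducible] def BarycentricAlgebra.ofConvex {A : Set C} (hA : Convex ℝ≥0 A) :
    BarycentricAlgebra A where
  bary a x y := ⟨(BarycentricAlgebra.ofCone C).bary a x y,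
    hA x.2 y.2 zero_le zero_le (unitInterval.toNNReal_add_toNNReal_symm a)⟩
  bary_one x y := Subtype.ext ((BarycentricAlgebra.ofCone C).bary_one x y)
  bary_self a x := Subtype.ext ((BarycentricAlgebra.ofCone C).bary_self a x)
  bary_symm a x y := Subtype.ext ((BarycentricAlgebra.ofCone C).bary_symm a x y)
  bary_assoc a b c x y z ha hb hc :=
    Subtype.ext ((BarycentricAlgebra.ofCone C).bary_assoc a b c x y z ha hb hc)

end Cones

/-- A topological cone: addition and scalar multiplication are jointly continuous, where the
non-negative reals have their Scott topology. -/
structure IsTopologicalCone (C : Type*) [AddCommMonoid C] [Module ℝ≥0 C] [TopologicalSpace C] :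
    Prop where
  continuous_add : Continuous fun p : C × C => p.1 + p.2
  continuous_smul : Continuous fun p : WithScott ℝ≥0 × C => WithScott.ofScott p.1 • p.2

/-- A topological cone that is consistent, seen as a barycentric algebra. -/
def IsConsistentTopologicalCone (C : Type*) [AddCommMonoid C] [Module ℝ≥0 C]
    [TopologicalSpace C] : Prop :=
  IsTopologicalCone C ∧ @IsConsistent C (BarycentricAlgebra.ofCone C) _

/-- The subset `A` of a cone with a topology is convex and, with the induced operations and the
subspace topology, a strongly consistent topological barycentric algebra. -/
def IsStronglyConsistentTopologicalSubalgebra {C : Type*} [AddCommMonoid C] [Module ℝ≥0 C]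
    [TopologicalSpace C] (A : Set C) : Prop :=
  ∃ hA : Convex ℝ≥0 A,
    @IsTopologicalBarycentricAlgebra A (BarycentricAlgebra.ofConvex hA) _ ∧
    @IsStronglyConsistent A (BarycentricAlgebra.ofConvex hA) _

/-- The subset `A` of a cone with a topology is a subcone and, with the induced operations and the
subspace topology, a consistent topological cone. -/
def IsConsistentTopologicalSubcone {C : Type*} [AddCommMonoid C] [Module ℝ≥0 C]
    [TopologicalSpace C] (A : Set C) : Prop :=
  ∃ S : Submodule ℝ≥0 C, (S : Set C) = A ∧ IsConsistentTopologicalCone S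

/-! ### Continuous valuations -/

/-- A continuous valuation on `X`. -/
structure ContinuousValuation (X : Type*) [TopologicalSpace X] where
  toFun : Opens X → ℝ≥0∞
  strict' : toFun ⊥ = 0
  modular' : ∀ U V, toFun U + toFun V = toFun (U ⊔ V) + toFun (U ⊓ V)
  scott' : ScottContinuous toFun

namespace ContinuousValuation

section Aux

variable {P : Type*} [Preorder P]

lemma scottContinuous_ennreal_iff {f : P → ℝ≥0∞} : ScottContinuous f ↔ Monotone f ∧
    ∀ ⦃d : Set P⦄, d.Nonempty → DirectedOn (· ≤ ·) d → ∀ ⦃a⦄, IsLUB d a →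
      f a = ⨆ x : d, f x := by
  constructor
  · intro hf
    refine ⟨hf.monotone, fun d hne hd a ha => ?_⟩
    rw [← sSup_image']
    exact (hf hne hd ha).sSup_eq.symm
  · rintro ⟨_, h⟩ d hne hd a ha
    rw [h hne hd ha, ← sSup_image']
    exact isLUB_sSup _

lemma scott_add {f g : P → ℝ≥0∞} (hf : ScottContinuous f) (hg : ScottContinuous g) :
    ScottContinuous fun x => f x + g x := by
  rw [scottContinuous_ennreal_iff] at *
  refine ⟨hf.1.add hg.1, fun d hne hd a ha => ?_⟩
  rw [hf.2 hne hd ha, hg.2 hne hd ha]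
  refine ENNReal.iSup_add_iSup fun i j => ?_
  obtain ⟨k, hk, hik, hjk⟩ := hd i i.2 j j.2
  exact ⟨⟨k, hk⟩, add_le_add (hf.1 hik) (hg.1 hjk)⟩

lemma scott_mul {f : P → ℝ≥0∞} (c : ℝ≥0∞) (hf : ScottContinuous f) :
    ScottContinuous fun x => c * f x := by
  rw [scottContinuous_ennreal_iff] at *
  refine ⟨fun x y h => mul_le_mul_right (hf.1 h) _, fun d hne hd a ha => ?_⟩
  rw [hf.2 hne hd ha, ENNReal.mul_iSup]

end Aux

variable {X : Type*} [TopologicalSpace X]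

instance : FunLike (ContinuousValuation X) (Opens X) ℝ≥0∞ where
  coe := toFun
  coe_injective μ ν h := by cases μ; cases ν; congr

instance : Zero (ContinuousValuation X) where
  zero :=
    { toFun := fun _ => 0
      strict' := rfl
      modular' := fun _ _ => rfl
      scott' := scottContinuous_ennreal_iff.2 ⟨monotone_const, fun d _ _ _ _ => by simp⟩ }

instance : Add (ContinuousValuation X) where
  add μ ν :=
    { toFun := fun U => μ U + ν U
      strict' := by
        have h1 : μ ⊥ = 0 := μ.strict'
        have h2 : ν ⊥ = 0 := ν.strict'
        simp [h1, h2]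
      modular' := fun U V => by
        have h1 : μ U + μ V = μ (U ⊔ V) + μ (U ⊓ V) := μ.modular' U V
        have h2 : ν U + ν V = ν (U ⊔ V) + ν (U ⊓ V) := ν.modular' U V
        rw [add_add_add_comm, h1, h2, add_add_add_comm]
      scott' := scott_add μ.scott' ν.scott' }

/-- Scalar multiplication, with the convention `0 · ∞ = 0`. -/
instance {R : Type*} [SMul R ℝ≥0∞] [IsScalarTower R ℝ≥0∞ ℝ≥0∞] :
    SMul R (ContinuousValuation X) where
  smul c ν :=
    { toFun := fun U => c • ν U
      strict' := by
        have h : ν ⊥ = 0 := ν.strict'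
        rw [h, ← smul_one_mul, mul_zero]
      modular' := fun U V => by
        have h : ν U + ν V = ν (U ⊔ V) + ν (U ⊓ V) := ν.modular' U V
        rw [← smul_one_mul c (ν U), ← smul_one_mul c (ν V), ← mul_add, h, mul_add,
          smul_one_mul, smul_one_mul]
      scott' := by
        have h := scott_mul (c • (1 : ℝ≥0∞)) ν.scott'
        simp only [smul_one_mul] at h
        exact h }

noncomputable instance : AddCommMonoid (ContinuousValuation X) :=
  DFunLike.coe_injective.addCommMonoid (fun ν : ContinuousValuation X => (ν : Opens X → ℝ≥0∞))
    rfl (fun _ _ => rfl) (fun _ _ => rfl)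

/-- Evaluation of a valuation at all open sets, as an additive map. -/
noncomputable def coeAddHom : ContinuousValuation X →+ (Opens X → ℝ≥0∞) where
  toFun ν := ν
  map_zero' := rfl
  map_add' _ _ := rfl

/-- Continuous valuations form a cone, with pointwise operations. -/
noncomputable instance : Module ℝ≥0 (ContinuousValuation X) :=
  DFunLike.coe_injective.module ℝ≥0 coeAddHom (fun _ _ => rfl)

/-- The stochastic ordering. -/
instance : PartialOrder (ContinuousValuation X) :=
  PartialOrder.lift (fun ν : ContinuousValuation X => (ν : Opens X → ℝ≥0∞)) DFunLike.coe_injective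

/-- The weak topology, with subbasic open sets `[U > r]`, `U` open in `X`, `r > 0` real. -/
instance : TopologicalSpace (ContinuousValuation X) :=
  generateFrom {W | ∃ (U : Opens X) (r : ℝ≥0), r ≠ 0 ∧
    W = {ν : ContinuousValuation X | (r : ℝ≥0∞) < ν U}}

open Classical in
/-- The Dirac valuation at `x`. -/
noncomputable def dirac (x : X) : ContinuousValuation X where
  toFun U := if x ∈ U then 1 else 0
  strict' := if_neg (fun h => h)
  modular' U V := by
    by_cases hU : x ∈ U <;> by_cases hV : x ∈ V <;> simp [hU, hV]
  scott' := by
    rw [scottContinuous_ennreal_iff]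
    refine ⟨fun U V h => ?_, fun d _ _ a ha => ?_⟩
    · by_cases hU : x ∈ U
      · simp [hU, h hU]
      · simp [hU]
    · have hx : x ∈ a ↔ ∃ U ∈ d, x ∈ U := by
        rw [← ha.sSup_eq, Opens.mem_sSup]
      by_cases h : x ∈ a
      · obtain ⟨U, hU, hxU⟩ := hx.1 h
        rw [if_pos h]
        refine le_antisymm ?_ (iSup_le fun V => ?_)
        · exact le_iSup_of_le ⟨U, hU⟩ (by simp [hxU])
        · split_ifs <;> simp
      · rw [if_neg h]
        refine (ENNReal.iSup_eq_zero.2 fun V => if_neg fun hV => h (hx.2 ⟨V.1, V.2, hV⟩)).symm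

/-- A valuation is bounded if the mass of the whole space is finite. -/
def IsBounded (ν : ContinuousValuation X) : Prop := ν ⊤ < ∞

lemma IsBounded.smul {ν : ContinuousValuation X} (h : ν.IsBounded) (r : ℝ≥0) :
    (r • ν).IsBounded :=
  ENNReal.mul_lt_top ENNReal.coe_lt_top h

lemma IsBounded.ne_top {ν : ContinuousValuation X} (h : ν.IsBounded) (U : Opens X) : ν U ≠ ∞ :=
  ne_top_of_le_ne_top h.ne (ν.scott'.monotone le_top)

/-- The mass `ν (U ∖ V) = ν (U ∪ V) - ν V` that a bounded valuation gives to the crescent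
`U ∖ V`. -/
noncomputable def crescentMass (ν : ContinuousValuation X) (U V : Opens X) : ℝ≥0∞ :=
  ν (U ⊔ V) - ν V

/-- The mass of a crescent does not depend on the two open sets that represent it. -/
lemma crescentMass_congr {ν : ContinuousValuation X} (h : ν.IsBounded) {U V U' V' : Opens X}
    (hC : (U : Set X) \ V = (U' : Set X) \ V') : ν.crescentMass U V = ν.crescentMass U' V' := by
  have key : ∀ {A B A' B' : Opens X}, (A : Set X) \ B = (A' : Set X) \ B' →
      ν.crescentMass A B = ν (A ⊓ A') - ν (A ⊓ A' ⊓ B) := by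
    intro A B A' B' hAB
    have h1 : A ⊔ B = (A ⊓ A') ⊔ B := by
      ext x
      have := Set.ext_iff.1 hAB x
      simp only [Set.mem_sdiff, SetLike.mem_coe, Opens.coe_sup, Opens.coe_inf, mem_union,
        mem_inter_iff] at this ⊢
      tauto
    have h2 : ν (A ⊓ A') + ν B = ν ((A ⊓ A') ⊔ B) + ν (A ⊓ A' ⊓ B) := ν.modular' _ _
    unfold crescentMass
    rw [h1]
    refine ENNReal.sub_eq_of_eq_add (h.ne_top _) ?_
    have h3 : ν (A ⊓ A' ⊓ B) ≤ ν (A ⊓ A') := ν.scott'.monotone inf_le_left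
    obtain ⟨k, hk⟩ := exists_add_of_le h3
    rw [hk, ENNReal.add_sub_cancel_left (h.ne_top _)]
    rw [hk, add_assoc, add_comm (ν (A ⊓ A' ⊔ B))] at h2
    exact ((ENNReal.add_right_inj (h.ne_top _)).1 h2).symm
  rw [key hC, key hC.symm, inf_comm U' U]
  congr 2
  ext x
  have := Set.ext_iff.1 hC x
  simp only [Set.mem_sdiff, SetLike.mem_coe, Opens.coe_inf, mem_inter_iff] at this ⊢
  tauto

/-- The constriction `ν_{|C}` of a bounded continuous valuation `ν` to the crescent
`C = U ∖ V`: it maps `W` to `ν (W ∩ C) = ν ((W ∩ U) ∖ V)`. -/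
noncomputable def constriction (ν : ContinuousValuation X) (h : ν.IsBounded) (U V : Opens X) :
    ContinuousValuation X where
  toFun W := ν.crescentMass (W ⊓ U) V
  strict' := by simp [crescentMass]
  modular' W W' := by
    have hmono : ∀ A : Opens X, ν V ≤ ν (A ⊔ V) := fun A => ν.scott'.monotone le_sup_right
    have hm : ν ((W ⊓ U) ⊔ V) + ν ((W' ⊓ U) ⊔ V)
        = ν (((W ⊓ U) ⊔ V) ⊔ ((W' ⊓ U) ⊔ V)) + ν (((W ⊓ U) ⊔ V) ⊓ ((W' ⊓ U) ⊔ V)) :=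
      ν.modular' _ _
    have e1 : ((W ⊓ U) ⊔ V) ⊔ ((W' ⊓ U) ⊔ V) = ((W ⊔ W') ⊓ U) ⊔ V := by
      rw [inf_sup_right, sup_sup_sup_comm, sup_idem]
    have e2 : ((W ⊓ U) ⊔ V) ⊓ ((W' ⊓ U) ⊔ V) = ((W ⊓ W') ⊓ U) ⊔ V := by
      rw [← sup_inf_right, inf_inf_inf_comm, inf_idem]
    rw [e1, e2] at hm
    unfold crescentMass
    have hV := h.ne_top V
    have hk : ∀ A B : Opens X, ν (A ⊔ V) - ν V + (ν (B ⊔ V) - ν V)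
        = ν (A ⊔ V) + ν (B ⊔ V) - (ν V + ν V) := fun A B =>
      AddLECancellable.tsub_add_tsub_comm (ENNReal.cancel_of_ne hV) (ENNReal.cancel_of_ne hV)
        (hmono A) (hmono B)
    rw [hk, hk, hm]
  scott' := by
    have hν := scottContinuous_ennreal_iff.1 ν.scott'
    rw [scottContinuous_ennreal_iff]
    refine ⟨fun W W' hW => tsub_le_tsub_right (hν.1 (by gcongr)) _, fun d hne hd a ha => ?_⟩
    have hmon : Monotone fun W : Opens X => (W ⊓ U) ⊔ V := fun W W' hW => by
      dsimp only; gcongr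
    have hlub : IsLUB ((fun W : Opens X => (W ⊓ U) ⊔ V) '' d) ((a ⊓ U) ⊔ V) := by
      refine ⟨?_, fun B hB => ?_⟩
      · rintro _ ⟨W, hW, rfl⟩
        exact hmon (ha.1 hW)
      · obtain ⟨W₀, hW₀⟩ := hne
        have hVB : V ≤ B := le_sup_right.trans (hB ⟨W₀, hW₀, rfl⟩)
        refine sup_le ?_ hVB
        rw [← ha.sSup_eq, sSup_inf_eq]
        exact iSup₂_le fun W hW => le_sup_left.trans (hB ⟨W, hW, rfl⟩)
    have hdir : DirectedOn (· ≤ ·) ((fun W : Opens X => (W ⊓ U) ⊔ V) '' d) := by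
      rintro _ ⟨W, hW, rfl⟩ _ ⟨W', hW', rfl⟩
      obtain ⟨Z, hZ, h1, h2⟩ := hd W hW W' hW'
      exact ⟨_, ⟨Z, hZ, rfl⟩, hmon h1, hmon h2⟩
    unfold crescentMass
    have hs : ν ((a ⊓ U) ⊔ V) = ⨆ W : d, ν ((W.1 ⊓ U) ⊔ V) := by
      refine (hν.2 (hne.image _) hdir hlub).trans ?_
      rw [← sSup_image', image_image, sSup_image']
      rfl
    rw [hs, ENNReal.iSup_sub]

/-- `ξ` is a finite linear combination, with non-negative real coefficients, of constrictions of
the bounded continuous valuation `ν` to pairwise disjoint crescents. -/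
def IsCrescentCombination (ξ ν : ContinuousValuation X) (h : ν.IsBounded) : Prop :=
  ∃ (n : ℕ) (U V : Fin n → Opens X) (a : Fin n → ℝ≥0),
    (∀ i j, i ≠ j → Disjoint ((U i : Set X) \ V i) ((U j : Set X) \ V j)) ∧
    ξ = ∑ i, a i • ν.constriction h (U i) (V i)

/-- A simple valuation: a finite linear combination of Dirac valuations. -/
def IsSimple (ν : ContinuousValuation X) : Prop :=
  ∃ (n : ℕ) (a : Fin n → ℝ≥0) (x : Fin n → X), ν = ∑ i, a i • dirac (x i)

/-- The pointwise topology on the open sets of `X`, with subbasic open sets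
`{U | x ∈ U}`, `x ∈ X`. -/
@[reducible] def pointwiseTopology (X : Type*) [TopologicalSpace X] : TopologicalSpace (Opens X) :=
  generateFrom {W | ∃ x : X, W = {U : Opens X | x ∈ U}}

/-- A point-continuous valuation: one that is continuous from the pointwise topology to the Scott
topology of `[0, ∞]`. -/
def IsPointContinuous (ν : ContinuousValuation X) : Prop :=
  @Continuous (Opens X) (WithScott ℝ≥0∞) (pointwiseTopology X) _ fun U => WithScott.toScott (ν U)

variable (X)

/-- Bounded continuous valuations. -/
def bounded : Set (ContinuousValuation X) := {ν | ν.IsBounded}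

/-- Point-continuous valuations. -/
def pointContinuous : Set (ContinuousValuation X) := {ν | ν.IsPointContinuous}

/-- Simple valuations. -/
def simple : Set (ContinuousValuation X) := {ν | ν.IsSimple}

/-- Subprobability valuations. -/
def subprobability : Set (ContinuousValuation X) := {ν | ν ⊤ ≤ 1}

/-- Probability valuations. -/
def probability : Set (ContinuousValuation X) := {ν | ν ⊤ = 1}

end ContinuousValuation

/-! ### Transport of finite mass distributions along a relation -/

section Transport

/-! Continuity of the operations holds because evaluation at each open set is lower semicontinuous
and sums and products in `ℝ≥0∞` preserve this. The substance is strong consistency: if `a • μ + b •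
ϖ ≤ ν` with `μ ∈ U` and `ϖ ∈ V`, every `ν'` in `B` close to `ν` must dominate some `a • μ' + b • ϖ'`
of the same kind.

By directed suprema one may take `μ`, `ϖ` and `ν'` bounded. Membership in `U` and `V` then follows
from dominating `s • μ` and `s • ϖ` on finitely many open sets, for some `s < 1`. These sets cut `X`
into finitely many disjoint crescents, the cells, indexed by the set of those `O i` that contain a
given point. Under inclusion of indices, upper sets of cells have open unions. If `ν'` is close to
`ν`, it dominates `s • (a • μ + b • ϖ)` on all these unions, which is exactly Hall's condition for
moving the cell masses of `s • a • μ` and `s • b • ϖ` upwards into the cells within the capacity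
given by `ν'` (`exists_transport`, `exists_splitting`). Rescaling `ν'` on each cell to the two
transported amounts gives two valuations with sum below `ν'` (`exists_cellCombination`); dividing by
`a` and `b` gives `μ'` and `ϖ'`. Transport preserves total mass, so hypothesis (iii) puts them in
`B`.

The cones in the particular cases are closed under constriction, and `exists_directed_approximation`
supplies bounded approximants where they are needed. For probability valuations (ii) fails; that
case is deduced from subprobabilities by placing the missing mass at the least point, whose only
open neighborhood is `X`. -/

theorem Finset.sum_ite_mem_eq_union_sub {A M : Type*} [DecidableEq A] [AddCommGroup M]
    (s t : Finset A) (f : A → M) :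
    ∑ a ∈ t, (if a ∈ s then 0 else f a) = ∑ a ∈ s ∪ t, f a - ∑ a ∈ s, f a := by
  rw [← Finset.union_sdiff_self_eq_union, Finset.sum_union Finset.disjoint_sdiff,
    add_sub_cancel_left, Finset.sdiff_eq_filter, Finset.sum_filter]
  exact Finset.sum_congr rfl fun a _ => by by_cases h : a ∈ s <;> simp [h]

open Classical in
/-- The weighted form of Hall's marriage theorem: if every set of sources has at most the mass of
the set of sinks related to it, then the sources can be transported to the sinks along the
relation. -/
theorem exists_transport {A B : Type*} [Fintype A] [Fintype B] (R : A → B → Prop)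
    (m : A → ℝ) (n : B → ℝ) (hm : ∀ a, 0 ≤ m a) (hn : ∀ b, 0 ≤ n b)
    (hall : ∀ Z : Finset A,
      ∑ a ∈ Z, m a ≤ ∑ b ∈ Finset.univ.filter fun b => ∃ a ∈ Z, R a b, n b) :
    ∃ t : A → B → ℝ, (∀ a b, 0 ≤ t a b) ∧ (∀ a b, ¬ R a b → t a b = 0) ∧
      (∀ a, ∑ b, t a b = m a) ∧ ∀ b, ∑ a, t a b ≤ n b := by
  -- The induction is on the number of nonempty sources plus the number of sinks with remaining
  -- capacity.
  induction hN : (Finset.univ.filter fun a => m a ≠ 0).card +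
    (Finset.univ.filter fun b => n b ≠ 0).card using Nat.strong_induction_on generalizing m n with
  | _ N ih =>
  by_cases hm0 : ∀ a, m a = 0
  · exact ⟨fun _ _ => 0, by simp, by simp, by simp [hm0], by simpa using hn⟩
  push Not at hm0
  obtain ⟨a₀, ha₀⟩ := hm0
  have ha₀' : 0 < m a₀ := lt_of_le_of_ne (hm a₀) ha₀.symm
  obtain ⟨b₀, hR, hb₀⟩ : ∃ b, R a₀ b ∧ 0 < n b := by
    by_contra! hcon
    have h := hall {a₀}
    rw [Finset.sum_singleton] at h
    have h' : ∑ b ∈ Finset.univ.filter fun b => ∃ a ∈ ({a₀} : Finset A), R a b, n b ≤ 0 :=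
      Finset.sum_nonpos fun b hb => hcon b (by simpa using hb)
    linarith
  -- the neighborhood of a set of sources
  set G : Finset A → Finset B := fun Z => Finset.univ.filter fun b => ∃ a ∈ Z, R a b with hG
  have hGmem : ∀ Z b, b ∈ G Z ↔ ∃ a ∈ Z, R a b := by simp [hG]
  -- the amount that can be moved from `a₀` to `b₀`
  set P : Finset (Finset A) := Finset.univ.filter fun Z => a₀ ∉ Z ∧ b₀ ∈ G Z with hP
  -- A set in `P` loses capacity in its neighborhood but none of its own mass, so its slack bounds
  -- `ε`. The minimum may be `0`; the third alternative then holds, and progress comes from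
  -- splitting the problem.
  obtain ⟨ε, hε0, hεm, hεn, hεP, hε⟩ : ∃ ε : ℝ, 0 ≤ ε ∧ ε ≤ m a₀ ∧ ε ≤ n b₀ ∧
      (∀ Z ∈ P, ε ≤ ∑ b ∈ G Z, n b - ∑ a ∈ Z, m a) ∧
      (ε = m a₀ ∨ ε = n b₀ ∨ ∃ Z ∈ P, ε = ∑ b ∈ G Z, n b - ∑ a ∈ Z, m a) := by
    set E : Finset ℝ := insert (m a₀) (insert (n b₀)
      (P.image fun Z => ∑ b ∈ G Z, n b - ∑ a ∈ Z, m a)) with hE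
    have hEne : E.Nonempty := ⟨m a₀, by simp [hE]⟩
    have hmin := E.min'_mem hEne
    refine ⟨E.min' hEne, ?_, E.min'_le _ (by simp [hE]), E.min'_le _ (by simp [hE]),
      fun Z hZ => E.min'_le _ ?_, ?_⟩
    · refine Finset.le_min' _ _ _ fun y hy => ?_
      simp only [hE, Finset.mem_insert, Finset.mem_image] at hy
      rcases hy with rfl | rfl | ⟨Z, -, rfl⟩
      exacts [hm _, hn _, sub_nonneg.2 (hall Z)]
    · exact Finset.mem_insert_of_mem (Finset.mem_insert_of_mem (Finset.mem_image_of_mem _ hZ))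
    · generalize E.min' hEne = e at hmin
      simp only [hE, Finset.mem_insert, Finset.mem_image] at hmin
      rcases hmin with h | h | ⟨Z, hZ, h⟩
      exacts [Or.inl h, Or.inr (Or.inl h), Or.inr (Or.inr ⟨Z, hZ, h.symm⟩)]
  set m' : A → ℝ := fun a => m a - if a = a₀ then ε else 0 with hm'
  set n' : B → ℝ := fun b => n b - if b = b₀ then ε else 0 with hn'
  have hm'0 : ∀ a, 0 ≤ m' a := fun a => by
    simp only [hm']; split_ifs with h
    · subst h; linarith
    · linarith [hm a]
  have hn'0 : ∀ b, 0 ≤ n' b := fun b => by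
    simp only [hn']; split_ifs with h
    · subst h; linarith
    · linarith [hn b]
  have hm's : ∀ Z : Finset A, ∑ a ∈ Z, m' a = ∑ a ∈ Z, m a - if a₀ ∈ Z then ε else 0 := fun Z => by
    simp [hm', Finset.sum_sub_distrib]
  have hn's : ∀ Z : Finset B, ∑ a ∈ Z, n' a = ∑ a ∈ Z, n a - if b₀ ∈ Z then ε else 0 := fun Z => by
    simp [hn', Finset.sum_sub_distrib]
  have hall' : ∀ Z : Finset A, ∑ a ∈ Z, m' a ≤ ∑ b ∈ G Z, n' b := fun Z => by
    have h := hall Z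
    change _ ≤ ∑ b ∈ G Z, n b at h
    rw [hm's, hn's]
    by_cases h1 : a₀ ∈ Z
    · rw [if_pos h1, if_pos ((hGmem _ _).2 ⟨a₀, h1, hR⟩)]; linarith
    · rw [if_neg h1]
      split_ifs with h2
      · have := hεP Z (by simp [hP, h1, h2])
        linarith
      · linarith
  have hsm : ∀ a, m' a ≠ 0 → m a ≠ 0 := fun a h h0 => by
    have : m' a ≤ m a := by simp only [hm']; split_ifs <;> linarith
    exact h (le_antisymm (this.trans h0.le) (hm'0 a))
  have hsn : ∀ b, n' b ≠ 0 → n b ≠ 0 := fun a h h0 => by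
    have : n' a ≤ n a := by simp only [hn']; split_ifs <;> linarith
    exact h (le_antisymm (this.trans h0.le) (hn'0 a))
  -- it suffices to solve the problem that remains
  suffices ∃ t : A → B → ℝ, (∀ a b, 0 ≤ t a b) ∧ (∀ a b, ¬ R a b → t a b = 0) ∧
      (∀ a, ∑ b, t a b = m' a) ∧ ∀ b, ∑ a, t a b ≤ n' b by
    obtain ⟨t, ht0, htR, htm, htn⟩ := this
    refine ⟨fun a b => t a b + if a = a₀ ∧ b = b₀ then ε else 0, fun a b => ?_, fun a b h => ?_,
      fun a => ?_, fun b => ?_⟩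
    · have := ht0 a b
      dsimp only; split_ifs <;> linarith
    · dsimp only
      rw [htR a b h, if_neg, add_zero]
      rintro ⟨rfl, rfl⟩; exact h hR
    · rw [Finset.sum_add_distrib, htm]
      by_cases h : a = a₀ <;> simp [hm', h]
    · rw [Finset.sum_add_distrib]
      have := htn b
      by_cases h : b = b₀ <;> simp [hn', h] at this ⊢ <;> linarith
  have hlt : ∀ (m₁ : A → ℝ) (n₁ : B → ℝ), (∀ a, m₁ a ≠ 0 → m a ≠ 0) → (∀ b, n₁ b ≠ 0 → n b ≠ 0) →
      (m₁ a₀ = 0 ∨ n₁ b₀ = 0) → (Finset.univ.filter fun a => m₁ a ≠ 0).card +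
        (Finset.univ.filter fun b => n₁ b ≠ 0).card < N := by
    intro m₁ n₁ h1 h2 h3
    have s1 : (Finset.univ.filter fun a => m₁ a ≠ 0) ⊆ Finset.univ.filter fun a => m a ≠ 0 :=
      Finset.monotone_filter_right _ fun a _ => h1 a
    have s2 : (Finset.univ.filter fun a => n₁ a ≠ 0) ⊆ Finset.univ.filter fun a => n a ≠ 0 :=
      Finset.monotone_filter_right _ fun a _ => h2 a
    rw [← hN]
    rcases h3 with h3 | h3
    · refine add_lt_add_of_lt_of_le (Finset.card_lt_card ⟨s1, fun h => ?_⟩)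
        (Finset.card_le_card s2)
      have := h (Finset.mem_filter.2 ⟨Finset.mem_univ a₀, ha₀⟩)
      simp [h3] at this
    · refine add_lt_add_of_le_of_lt (Finset.card_le_card s1)
        (Finset.card_lt_card ⟨s2, fun h => ?_⟩)
      have := h (Finset.mem_filter.2 ⟨Finset.mem_univ b₀, hb₀.ne'⟩)
      simp [h3] at this
  rcases hε with hε | hε | ⟨Z, hZ, hε⟩
  · exact ih _ (hlt m' n' hsm hsn (Or.inl (by simp [hm', hε]))) m' n' hm'0 hn'0 hall' rfl
  · exact ih _ (hlt m' n' hsm hsn (Or.inr (by simp [hn', hε]))) m' n' hm'0 hn'0 hall' rfl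
  -- the set `Z` is tight, and the problem splits
  obtain ⟨haZ, hbZ⟩ : a₀ ∉ Z ∧ b₀ ∈ G Z := by simpa [hP] using hZ
  have htight : ∑ a ∈ Z, m' a = ∑ b ∈ G Z, n' b := by
    rw [hm's, hn's, if_neg haZ, if_pos hbZ, hε]; ring
  -- Transport from `Z` into `G Z`. This subproblem is smaller because it omits `a₀`; the
  -- complementary one omits `b₀`.
  obtain ⟨t₁, ht₁0, ht₁R, ht₁m, ht₁n⟩ := ih _
    (hlt (fun a => if a ∈ Z then m' a else 0) (fun b => if b ∈ G Z then n' b else 0)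
      (fun a h => hsm a (ite_ne_right_iff.1 h).2)
      (fun b h => hsn b (ite_ne_right_iff.1 h).2) (Or.inl (if_neg haZ))) _ _
    (fun a => by split_ifs <;> simp [hm'0]) (fun b => by split_ifs <;> simp [hn'0]) (fun Y => by
      rw [← Finset.sum_filter, Finset.filter_mem_eq_inter, ← Finset.sum_filter,
        Finset.filter_mem_eq_inter]
      refine (hall' _).trans (Finset.sum_le_sum_of_subset_of_nonneg ?_ fun b _ _ => hn'0 b)
      intro b hb
      obtain ⟨a, ha, hab⟩ := (hGmem _ _).1 hb
      rw [Finset.mem_inter] at ha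
      exact Finset.mem_inter.2 ⟨(hGmem _ _).2 ⟨a, ha.1, hab⟩, (hGmem _ _).2 ⟨a, ha.2, hab⟩⟩) rfl
  -- Hall's condition outside `Z` is the condition for `Z ∪ Y` minus the equality `htight`.
  obtain ⟨t₂, ht₂0, ht₂R, ht₂m, ht₂n⟩ := ih _
    (hlt (fun a => if a ∈ Z then 0 else m' a) (fun b => if b ∈ G Z then 0 else n' b)
      (fun a h => hsm a (ite_ne_left_iff.1 h).2.symm)
      (fun b h => hsn b (ite_ne_left_iff.1 h).2.symm) (Or.inr (if_pos hbZ))) _ _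
    (fun a => by split_ifs <;> simp [hm'0]) (fun b => by split_ifs <;> simp [hn'0]) (fun Y => by
      have h := hall' (Z ∪ Y)
      have hGu : G (Z ∪ Y) = G Z ∪ G Y := by
        ext b
        simp only [hGmem, Finset.mem_union, or_and_right, exists_or]
      rw [hGu] at h
      change _ ≤ ∑ b ∈ G Y, _
      rw [Finset.sum_ite_mem_eq_union_sub, Finset.sum_ite_mem_eq_union_sub]
      linarith) rfl
  refine ⟨fun a b => t₁ a b + t₂ a b, fun a b => add_nonneg (ht₁0 a b) (ht₂0 a b),
    fun a b h => by dsimp only; rw [ht₁R a b h, ht₂R a b h, add_zero], fun a => ?_, fun b => ?_⟩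
  · rw [Finset.sum_add_distrib, ht₁m, ht₂m]
    by_cases h : a ∈ Z <;> simp [h]
  · rw [Finset.sum_add_distrib]
    have h1 := ht₁n b
    have h2 := ht₂n b
    by_cases h : b ∈ G Z <;> simp only [h, if_true, if_false] at h1 h2 <;> linarith

open Classical in
/-- If `m₁ + m₂` is dominated by `n` on all upper sets of a finite preorder, then `n` dominates
pointwise a sum `u₁ + u₂` where `uᵢ` has the same total mass as `mᵢ` and dominates it on all
upper sets. -/
theorem exists_splitting {K : Type*} [Fintype K] [Preorder K] (m₁ m₂ n : K → ℝ≥0)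
    (h : ∀ S : Finset K, IsUpperSet (S : Set K) → ∑ k ∈ S, (m₁ k + m₂ k) ≤ ∑ k ∈ S, n k) :
    ∃ u₁ u₂ : K → ℝ≥0, (∀ k, u₁ k + u₂ k ≤ n k) ∧ (∑ k, u₁ k = ∑ k, m₁ k) ∧
      (∑ k, u₂ k = ∑ k, m₂ k) ∧ ∀ S : Finset K, IsUpperSet (S : Set K) →
        ∑ k ∈ S, m₁ k ≤ ∑ k ∈ S, u₁ k ∧ ∑ k ∈ S, m₂ k ≤ ∑ k ∈ S, u₂ k := by
  -- The sources are two copies of `K`, carrying `m₁` and `m₂`, and mass may only move upwards. The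
  -- neighborhood of any set of sources is an upper set, so `h` gives Hall's condition; `u₁` and
  -- `u₂` record what arrives from each copy.
  obtain ⟨t, ht0, htR, htm, htn⟩ := exists_transport (A := K ⊕ K) (B := K)
    (fun a b => Sum.elim id id a ≤ b) (fun a => ((Sum.elim m₁ m₂ a : ℝ≥0) : ℝ)) (fun b => (n b : ℝ))
    (fun _ => NNReal.coe_nonneg _) (fun _ => NNReal.coe_nonneg _) (fun Z => by
      set S : Finset K := Finset.univ.filter fun b => ∃ a ∈ Z, Sum.elim id id a ≤ b with hS
      have hup : IsUpperSet (S : Set K) := by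
        intro x y hxy hx
        simp only [hS, Finset.coe_filter, Finset.mem_univ, true_and, mem_ofPred_eq] at hx ⊢
        obtain ⟨a, ha, hax⟩ := hx
        exact ⟨a, ha, hax.trans hxy⟩
      have hZ : Z ⊆ S.disjSum S := by
        intro a ha
        have : Sum.elim id id a ∈ S := by
          simp only [hS, Finset.mem_filter, Finset.mem_univ, true_and]
          exact ⟨a, ha, le_rfl⟩
        rcases a with a | a <;> simpa using this
      have h1 := Finset.sum_le_sum_of_subset (f := Sum.elim m₁ m₂) hZ
      rw [Finset.sum_disjSum] at h1
      have h2 := h S hup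
      rw [Finset.sum_add_distrib] at h2
      exact_mod_cast h1.trans h2)
  lift t to K ⊕ K → K → ℝ≥0 using ht0
  replace htR : ∀ a b, ¬ Sum.elim id id a ≤ b → t a b = 0 := fun a b h => NNReal.eq (htR a b h)
  replace htm : ∀ a, ∑ b, t a b = Sum.elim m₁ m₂ a :=
    fun a => NNReal.eq ((NNReal.coe_sum _ _).trans (htm a))
  replace htn : ∀ b, ∑ a, t a b ≤ n b :=
    fun b => NNReal.coe_le_coe.1 ((NNReal.coe_sum _ _).trans_le (htn b))
  -- Mass that starts in an upper set stays in it.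
  have hS : ∀ (f : K → K ⊕ K) (m : K → ℝ≥0), (∀ k, Sum.elim id id (f k) = k) →
      (∀ k, Sum.elim m₁ m₂ (f k) = m k) → ∀ S : Finset K, IsUpperSet (S : Set K) →
        ∑ k ∈ S, m k ≤ ∑ k ∈ S, ∑ j, t (f j) k := by
    intro f m hf hm S hup
    calc ∑ k ∈ S, m k = ∑ k ∈ S, ∑ j, t (f k) j := by simp only [htm, hm]
      _ = ∑ k ∈ S, ∑ j ∈ S, t (f k) j := by
        refine Finset.sum_congr rfl fun k hk => (Finset.sum_subset (Finset.subset_univ S)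
          fun j _ hj => htR _ _ fun hkj => hj ?_).symm
        rw [hf] at hkj
        exact hup hkj hk
      _ ≤ ∑ k, ∑ j ∈ S, t (f k) j := Finset.sum_le_sum_of_subset (Finset.subset_univ S)
      _ = ∑ k ∈ S, ∑ j, t (f j) k := Finset.sum_comm
  refine ⟨fun k => ∑ j, t (Sum.inl j) k, fun k => ∑ j, t (Sum.inr j) k, fun k => ?_, ?_, ?_,
    fun S hup => ⟨?_, ?_⟩⟩
  · rw [← Fintype.sum_sum_type (fun a => t a k)]
    exact htn k
  · rw [Finset.sum_comm]
    simp only [htm, Sum.elim_inl]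
  · rw [Finset.sum_comm]
    simp only [htm, Sum.elim_inr]
  · exact hS Sum.inl m₁ (fun _ => rfl) (fun _ => rfl) S hup
  · exact hS Sum.inr m₂ (fun _ => rfl) (fun _ => rfl) S hup

end Transport

/-! ### Lower semicontinuity and the Scott topology -/

theorem LowerSemicontinuous.ennreal_mul {P : Type*} [TopologicalSpace P] {f g : P → ℝ≥0∞}
    (hf : LowerSemicontinuous f) (hg : LowerSemicontinuous g) :
    LowerSemicontinuous fun p => f p * g p := by
  intro p c hc
  obtain ⟨a, ha, b, hb, hab⟩ : ∃ a < f p, ∃ b < g p, c < a * b := by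
    by_contra! h
    exact (ENNReal.mul_le_of_forall_lt h).not_gt hc
  filter_upwards [hf p a ha, hg p b hb] with q h1 h2
  exact hab.trans (ENNReal.mul_lt_mul h1 h2)

/-- In a complete linear order the Scott-open sets are the whole space and the complements of the
sets `Iic a`. -/
theorem continuous_toScott_iff {P : Type*} [TopologicalSpace P] {f : P → ℝ≥0∞} :
    Continuous (fun p => WithScott.toScott (f p)) ↔ LowerSemicontinuous f := by
  rw [lowerSemicontinuous_iff_isOpen_preimage]
  constructor
  · intro h r
    have h1 : IsOpen (Iic (WithScott.toScott r))ᶜ := isClosed_Iic.isOpen_compl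
    have h2 := h1.preimage h
    convert h2 using 1
    ext p
    exact (not_le (a := f p) (b := r)).symm
  · intro h
    refine ⟨fun s hs => ?_⟩
    let _ : TopologicalSpace ℝ≥0∞ := scott ℝ≥0∞ univ
    have hS : IsScott ℝ≥0∞ univ := ⟨rfl⟩
    rcases (IsScott.isOpen_iff_Iic_compl_or_univ (α := ℝ≥0∞) s).1 hs with rfl | ⟨a, rfl⟩
    · exact isOpen_univ
    · convert h a using 1
      ext p
      exact not_le (a := f p) (b := a)

theorem lowerSemicontinuous_ofScott :
    LowerSemicontinuous fun a : WithScott ℝ≥0 => ((WithScott.ofScott a : ℝ≥0) : ℝ≥0∞) := by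
  intro a c hc
  lift c to ℝ≥0 using hc.ne_top
  have h1 : IsOpen (Iic (WithScott.toScott c))ᶜ := isClosed_Iic.isOpen_compl
  have h2 : a ∈ (Iic (WithScott.toScott c))ᶜ := fun h => (ENNReal.coe_lt_coe.1 hc).not_ge h
  filter_upwards [h1.mem_nhds h2] with b hb
  exact ENNReal.coe_lt_coe.2 (not_le.1 hb)

namespace ContinuousValuation

variable {X : Type*} [TopologicalSpace X]

theorem mono (ν : ContinuousValuation X) {U V : Opens X} (h : U ≤ V) : ν U ≤ ν V :=
  ν.scott'.monotone h

theorem bot_apply (ν : ContinuousValuation X) : ν ⊥ = 0 := ν.strict'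

theorem modular (ν : ContinuousValuation X) (U V : Opens X) :
    ν U + ν V = ν (U ⊔ V) + ν (U ⊓ V) := ν.modular' U V

theorem le_iff {μ ν : ContinuousValuation X} : μ ≤ ν ↔ ∀ U, μ U ≤ ν U := Iff.rfl

theorem add_apply (μ ν : ContinuousValuation X) (U : Opens X) : (μ + ν) U = μ U + ν U := rfl

theorem smul_apply (c : ℝ≥0) (ν : ContinuousValuation X) (U : Opens X) : (c • ν) U = c * ν U := rfl

theorem sum_apply {ι : Type*} (s : Finset ι) (ν : ι → ContinuousValuation X) (U : Opens X) :
    (∑ i ∈ s, ν i) U = ∑ i ∈ s, ν i U :=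
  (congrFun (map_sum (coeAddHom (X := X)) ν s) U).trans (Finset.sum_apply _ _ _)

theorem iSup_directed (ν : ContinuousValuation X) {d : Set (Opens X)} (hne : d.Nonempty)
    (hd : DirectedOn (· ≤ ·) d) : ν (sSup d) = ⨆ U : d, ν U :=
  (scottContinuous_ennreal_iff.1 ν.scott').2 hne hd (isLUB_sSup d)

/-! ### The weak topology -/

theorem lowerSemicontinuous_eval (U : Opens X) :
    LowerSemicontinuous fun ν : ContinuousValuation X => ν U := by
  intro ν c hc
  obtain ⟨r, hcr, hr⟩ := exists_between hc
  lift r to ℝ≥0 using hr.ne_top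
  have ho : IsOpen {ν : ContinuousValuation X | (r : ℝ≥0∞) < ν U} :=
    isOpen_generateFrom_of_mem ⟨U, r, by rintro rfl; simp at hcr, rfl⟩
  filter_upwards [ho.mem_nhds hr] with μ hμ
  exact hcr.trans hμ

theorem isOpen_lt (U : Opens X) (c : ℝ≥0∞) : IsOpen {ν : ContinuousValuation X | c < ν U} :=
  (lowerSemicontinuous_eval U).isOpen_preimage c

theorem continuous_iff {P : Type*} [TopologicalSpace P] {f : P → ContinuousValuation X} :
    Continuous f ↔ ∀ U, LowerSemicontinuous fun p => f p U := by
  refine ⟨fun h U => (lowerSemicontinuous_eval U).comp h, fun h => ?_⟩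
  refine continuous_generateFrom_iff.2 ?_
  rintro _ ⟨U, r, -, rfl⟩
  exact (h U).isOpen_preimage r

/-- This turns the upward closure in the definition of consistency into domination in the stochastic
ordering. -/
theorem specializes_iff {μ ν : ContinuousValuation X} : ν ⤳ μ ↔ μ ≤ ν := by
  constructor
  · intro h U
    refine le_of_forall_lt fun c hc => ?_
    exact specializes_iff_forall_open.1 h _ (isOpen_lt U c) hc
  · intro h
    refine specializes_iff_forall_open.2 fun W hW hμ => ?_
    induction hW with
    | basic W hW =>
      obtain ⟨U, r, -, rfl⟩ := hW
      exact lt_of_lt_of_le hμ (h U)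
    | univ => trivial
    | inter _ _ _ _ h1 h2 => exact ⟨h1 hμ.1, h2 hμ.2⟩
    | sUnion S _ ih =>
      obtain ⟨W, hW, hμW⟩ := hμ
      exact ⟨W, hW, ih W hW hμW⟩

theorem mem_of_le {W : Set (ContinuousValuation X)} (hW : IsOpen W) {μ ν : ContinuousValuation X}
    (h : μ ≤ ν) (hμ : μ ∈ W) : ν ∈ W :=
  specializes_iff_forall_open.1 (specializes_iff.2 h) W hW hμ

theorem isTopologicalCone : IsTopologicalCone (ContinuousValuation X) where
  continuous_add := continuous_iff.2 fun U =>
    ((lowerSemicontinuous_eval U).comp continuous_fst).add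
      ((lowerSemicontinuous_eval U).comp continuous_snd)
  continuous_smul := continuous_iff.2 fun U =>
    (lowerSemicontinuous_ofScott.comp continuous_fst).ennreal_mul
      ((lowerSemicontinuous_eval U).comp continuous_snd)

/-- Every open neighborhood of `μ` contains all the valuations that dominate `s • μ` on finitely
many open sets, for some `s < 1`. -/
theorem exists_finset_of_mem_isOpen {W : Set (ContinuousValuation X)} (hW : IsOpen W)
    {μ : ContinuousValuation X} (hμ : μ ∈ W) :
    ∃ (F : Set (Opens X)) (s : ℝ≥0), F.Finite ∧ 0 < s ∧ s < 1 ∧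
      ∀ ν : ContinuousValuation X, (∀ U ∈ F, s * μ U ≤ ν U) → ν ∈ W := by
  induction hW with
  | basic W hW =>
    obtain ⟨U, r, -, rfl⟩ := hW
    change (r : ℝ≥0∞) < μ U at hμ
    obtain ⟨s, hs, hrs⟩ : ∃ s < (1 : ℝ≥0∞), (r : ℝ≥0∞) < s * μ U := by
      by_contra! h
      rw [← one_mul (μ U)] at hμ
      exact (ENNReal.mul_le_of_forall_lt fun a ha b hb =>
        (mul_le_mul_right hb.le _).trans (h a ha)).not_gt hμ
    lift s to ℝ≥0 using hs.ne_top
    refine ⟨{U}, s, finite_singleton U, ?_, by exact_mod_cast hs, fun ν hν => ?_⟩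
    · rw [pos_iff_ne_zero]
      rintro rfl
      simp at hrs
    · exact hrs.trans_le (hν U rfl)
  | univ => exact ⟨∅, 1 / 2, finite_empty, by norm_num, by
      rw [← NNReal.coe_lt_coe]; norm_num, fun _ _ => trivial⟩
  | inter _ _ _ _ h1 h2 =>
    obtain ⟨F₁, s₁, hF₁, h01, h11, H₁⟩ := h1 hμ.1
    obtain ⟨F₂, s₂, hF₂, h02, h12, H₂⟩ := h2 hμ.2
    refine ⟨F₁ ∪ F₂, max s₁ s₂, hF₁.union hF₂, lt_max_of_lt_left h01, max_lt h11 h12,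
      fun ν hν => ⟨H₁ ν fun U hU => ?_, H₂ ν fun U hU => ?_⟩⟩
    · refine le_trans (mul_le_mul_left ?_ _) (hν U (Or.inl hU))
      exact_mod_cast le_max_left s₁ s₂
    · refine le_trans (mul_le_mul_left ?_ _) (hν U (Or.inr hU))
      exact_mod_cast le_max_right s₁ s₂
  | sUnion S _ ih =>
    obtain ⟨W, hW, hμW⟩ := hμ
    obtain ⟨F, s, hF, h0, h1, H⟩ := ih W hW hμW
    exact ⟨F, s, hF, h0, h1, fun ν hν => ⟨W, hW, H ν hν⟩⟩

/-! ### Directed suprema -/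

/-- The pointwise supremum of a directed set of continuous valuations. -/
noncomputable def directedSup (D : Set (ContinuousValuation X)) (hD : DirectedOn (· ≤ ·) D) :
    ContinuousValuation X where
  toFun U := ⨆ ν : D, ν.1 U
  strict' := by simp [bot_apply]
  modular' U V := by
    have key : ∀ A B : Opens X, (⨆ ν : D, ν.1 A) + (⨆ ν : D, ν.1 B) = ⨆ ν : D, (ν.1 A + ν.1 B) :=
      fun A B => ENNReal.iSup_add_iSup fun i j => by
        obtain ⟨k, hk, hik, hjk⟩ := hD i i.2 j j.2
        exact ⟨⟨k, hk⟩, add_le_add (hik A) (hjk B)⟩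
    rw [key, key]
    exact iSup_congr fun ν => ν.1.modular U V
  scott' := by
    rw [scottContinuous_ennreal_iff]
    refine ⟨fun U V h => iSup_mono fun ν => ν.1.mono h, fun d hne hd a ha => ?_⟩
    rw [← ha.sSup_eq, iSup_comm]
    exact iSup_congr fun ν => ν.1.iSup_directed hne hd

/-- Directed suprema are computed pointwise, since the pointwise supremum is again a continuous
valuation. -/
theorem isLUB_iff {D : Set (ContinuousValuation X)} (hD : DirectedOn (· ≤ ·) D)
    {ν : ContinuousValuation X} : IsLUB D ν ↔ ∀ U, ν U = ⨆ μ : D, μ.1 U := by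
  have h : IsLUB D (directedSup D hD) :=
    ⟨fun μ hμ U => le_iSup_of_le (⟨μ, hμ⟩ : D) le_rfl,
      fun μ hμ U => iSup_le fun ξ : D => hμ ξ.2 U⟩
  constructor
  · intro hν U
    rw [hν.unique h]
    rfl
  · intro hν
    rwa [show ν = directedSup D hD from DFunLike.ext _ _ hν]

/-- Weakly open sets are inaccessible by directed suprema. This is what allows bounded elements to
replace arbitrary ones without leaving a neighborhood. -/
theorem exists_mem_of_isLUB {D : Set (ContinuousValuation X)} (hne : D.Nonempty)
    (hD : DirectedOn (· ≤ ·) D) {ν : ContinuousValuation X} (hν : IsLUB D ν)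
    {W : Set (ContinuousValuation X)} (hW : IsOpen W) (hνW : ν ∈ W) : ∃ μ ∈ D, μ ∈ W := by
  have hW' := hW
  induction hW with
  | basic W hW =>
    obtain ⟨U, r, -, rfl⟩ := hW
    change (r : ℝ≥0∞) < ν U at hνW
    rw [(isLUB_iff hD).1 hν U, lt_iSup_iff] at hνW
    obtain ⟨μ, hμ⟩ := hνW
    exact ⟨μ, μ.2, hμ⟩
  | univ => exact ⟨_, hne.some_mem, trivial⟩
  | inter W₁ W₂ hW₁ hW₂ h1 h2 =>
    obtain ⟨μ₁, h1, h1W⟩ := h1 hνW.1 hW₁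
    obtain ⟨μ₂, h2, h2W⟩ := h2 hνW.2 hW₂
    obtain ⟨μ, hμ, h1μ, h2μ⟩ := hD μ₁ h1 μ₂ h2
    exact ⟨μ, hμ, mem_of_le hW₁ h1μ h1W, mem_of_le hW₂ h2μ h2W⟩
  | sUnion S hS ih =>
    obtain ⟨W, hW, hνW⟩ := hνW
    obtain ⟨μ, hμ, h⟩ := ih W hW hνW (hS W hW)
    exact ⟨μ, hμ, W, hW, h⟩

end ContinuousValuation

namespace ContinuousValuation

variable {X : Type*} [TopologicalSpace X]

/-! ### The cells of a finite family of open sets -/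

section Cells

variable {ι : Type*}

/-- The intersection of the `O i` with `i ∈ S`. -/
def cellInf (O : ι → Opens X) (S : Finset ι) : Opens X := S.inf O

/-- The union of the `O i` with `i ∉ S`. -/
def cellSup (O : ι → Opens X) (S : Finset ι) : Opens X := ⨆ (i) (_ : i ∉ S), O i

/-- The union of the sets `cellInf O S` with `S ∈ 𝒮`. -/
def cellUnion (O : ι → Opens X) (𝒮 : Finset (Finset ι)) : Opens X := ⨆ S ∈ 𝒮, cellInf O S

variable {O : ι → Opens X}

theorem mem_cellInf {S : Finset ι} {x : X} : x ∈ cellInf O S ↔ ∀ i ∈ S, x ∈ O i := by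
  rw [← SetLike.mem_coe, cellInf, Opens.coe_finset_inf, Finset.inf_set_eq_iInter]
  simp

theorem mem_cellSup {S : Finset ι} {x : X} : x ∈ cellSup O S ↔ ∃ i, i ∉ S ∧ x ∈ O i := by
  simp [cellSup]

theorem mem_cellUnion {𝒮 : Finset (Finset ι)} {x : X} :
    x ∈ cellUnion O 𝒮 ↔ ∃ S ∈ 𝒮, x ∈ cellInf O S := by
  simp [cellUnion]

/-- The cell of `S` consists of the points whose set of indices `i` with `x ∈ O i` is exactly `S`.
-/
theorem mem_cell {S : Finset ι} {x : X} :
    x ∈ (cellInf O S : Set X) \ cellSup O S ↔ ∀ i, i ∈ S ↔ x ∈ O i := by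
  simp only [mem_sdiff, SetLike.mem_coe, mem_cellInf, mem_cellSup, not_exists, not_and]
  exact ⟨fun h i => ⟨h.1 i, fun hx => by_contra fun hi => h.2 i hi hx⟩,
    fun h => ⟨fun i hi => (h i).1 hi, fun i hi hx => hi ((h i).2 hx)⟩⟩

theorem disjoint_cells {S T : Finset ι} (h : S ≠ T) :
    Disjoint ((cellInf O S : Set X) \ cellSup O S) ((cellInf O T : Set X) \ cellSup O T) := by
  rw [Set.disjoint_left]
  intro x hS hT
  exact h (Finset.ext fun i => (mem_cell.1 hS i).trans (mem_cell.1 hT i).symm)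

/-- The mass of a cell. -/
noncomputable def cellMass (ν : ContinuousValuation X) (O : ι → Opens X) (S : Finset ι) : ℝ≥0 :=
  (ν.crescentMass (cellInf O S) (cellSup O S)).toNNReal

theorem crescentMass_ne_top {ν : ContinuousValuation X} (hν : ν.IsBounded) (U V : Opens X) :
    ν.crescentMass U V ≠ ∞ := ne_top_of_le_ne_top (hν.ne_top _) tsub_le_self

theorem coe_cellMass {ν : ContinuousValuation X} (hν : ν.IsBounded) (S : Finset ι) :
    (ν.cellMass O S : ℝ≥0∞) = ν.crescentMass (cellInf O S) (cellSup O S) :=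
  ENNReal.coe_toNNReal (crescentMass_ne_top hν _ _)

open Classical in
/-- Finite additivity of a bounded valuation on the cells that make up an open set. -/
theorem sum_crescentMass {ν : ContinuousValuation X} (hν : ν.IsBounded) (W : Opens X)
    (𝒮 : Finset (Finset ι)) (h𝒮 : IsUpperSet (𝒮 : Set (Finset ι))) :
    ∑ S ∈ 𝒮, ν.crescentMass (W ⊓ cellInf O S) (cellSup O S) = ν (W ⊓ cellUnion O 𝒮) := by
  induction 𝒮 using Finset.strongInduction with
  | H 𝒮 ih =>
  rcases 𝒮.eq_empty_or_nonempty with rfl | hne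
  · simp [cellUnion, bot_apply]
  -- Removing a minimal index leaves an upper set, and the part of `W` lost from the union is
  -- exactly its part in the cell of `S`.
  obtain ⟨S, hS, hmin⟩ := 𝒮.exists_minimal hne
  have hup : IsUpperSet ((𝒮.erase S : Finset (Finset ι)) : Set (Finset ι)) := by
    intro A B hAB hA
    simp only [Finset.coe_erase, mem_sdiff, Finset.mem_coe, mem_singleton_iff] at hA ⊢
    refine ⟨h𝒮 hAB hA.1, ?_⟩
    rintro rfl
    exact hA.2 (le_antisymm hAB (hmin hA.1 hAB))
  have hle : W ⊓ cellUnion O (𝒮.erase S) ≤ W ⊓ cellUnion O 𝒮 :=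
    inf_le_inf_left _ (biSup_mono fun A hA => Finset.mem_of_mem_erase hA)
  have hC : ((W ⊓ cellInf O S : Opens X) : Set X) \ (cellSup O S : Opens X)
      = ((W ⊓ cellUnion O 𝒮 : Opens X) : Set X) \ (W ⊓ cellUnion O (𝒮.erase S) : Opens X) := by
    ext x
    simp only [mem_sdiff, SetLike.mem_coe, Opens.mem_inf, not_and, mem_cellUnion]
    constructor
    · rintro ⟨⟨hW, hI⟩, hU⟩
      refine ⟨⟨hW, S, hS, hI⟩, fun _ ⟨A, hA, hxA⟩ => ?_⟩
      have hAS : A ≤ S := fun i hi => by_contra fun hiS =>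
        hU (mem_cellSup.2 ⟨i, hiS, mem_cellInf.1 hxA i hi⟩)
      exact Finset.ne_of_mem_erase hA
        (le_antisymm hAS (hmin (Finset.mem_of_mem_erase hA) hAS))
    · rintro ⟨⟨hW, A, hA, hxA⟩, hn⟩
      obtain rfl : A = S := by
        by_contra hne
        exact hn hW ⟨A, Finset.mem_erase.2 ⟨hne, hA⟩, hxA⟩
      refine ⟨⟨hW, hxA⟩, fun hx => ?_⟩
      obtain ⟨i, hi, hxi⟩ := mem_cellSup.1 hx
      have hins : insert i A ∈ 𝒮.erase A :=
        Finset.mem_erase.2 ⟨fun h => hi (h ▸ Finset.mem_insert_self i A),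
          h𝒮 (Finset.subset_insert i A) hA⟩
      refine hn hW ⟨_, hins, mem_cellInf.2 fun j hj => ?_⟩
      rcases Finset.mem_insert.1 hj with rfl | hj
      exacts [hxi, mem_cellInf.1 hxA j hj]
  rw [← Finset.add_sum_erase _ _ hS, ih _ (Finset.erase_ssubset hS) hup, crescentMass_congr hν hC,
    crescentMass, sup_eq_left.2 hle, tsub_add_cancel_of_le (ν.mono hle)]

theorem sum_cellMass {ν : ContinuousValuation X} (hν : ν.IsBounded) {𝒮 : Finset (Finset ι)}
    (h𝒮 : IsUpperSet (𝒮 : Set (Finset ι))) :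
    ((∑ S ∈ 𝒮, ν.cellMass O S : ℝ≥0) : ℝ≥0∞) = ν (cellUnion O 𝒮) := by
  rw [ENNReal.ofNNReal_finsetSum, ← top_inf_eq (cellUnion O 𝒮), ← sum_crescentMass hν ⊤ 𝒮 h𝒮]
  simp only [coe_cellMass hν, top_inf_eq]

variable [Fintype ι]

theorem cellUnion_univ : cellUnion O Finset.univ = ⊤ :=
  top_unique fun x _ => mem_cellUnion.2 ⟨∅, Finset.mem_univ _, mem_cellInf.2 (by simp)⟩

open Classical in
-- The indices containing `i` form an upper set, so domination on upper sets of cells includes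
-- domination on each `O i`.
theorem cellUnion_filter_mem (i : ι) : cellUnion O (Finset.univ.filter (i ∈ ·)) = O i := by
  ext x
  simp only [SetLike.mem_coe, mem_cellUnion, Finset.mem_filter, Finset.mem_univ, true_and,
    mem_cellInf]
  exact ⟨fun ⟨S, hi, h⟩ => h i hi, fun h => ⟨{i}, by simp, by simpa using h⟩⟩

/-- A linear combination of the constrictions of `ν` to the cells. -/
noncomputable def cellCombination {ν : ContinuousValuation X} (hν : ν.IsBounded) (O : ι → Opens X)
    (c : Finset ι → ℝ≥0) : ContinuousValuation X :=
  ∑ S, c S • ν.constriction hν (cellInf O S) (cellSup O S)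

theorem cellCombination_apply {ν : ContinuousValuation X} (hν : ν.IsBounded)
    (c : Finset ι → ℝ≥0) (W : Opens X) : cellCombination hν O c W =
      ∑ S, c S * ν.crescentMass (W ⊓ cellInf O S) (cellSup O S) := by
  rw [cellCombination, sum_apply]
  rfl

open Classical in
-- A cell with index in `𝒮` lies inside the union. One with index outside `𝒮` misses it: no `T ∈ 𝒮`
-- is contained in `S`, so `cellInf O T` lies in some `O i` with `i ∉ S`.
theorem cellCombination_cellUnion {ν : ContinuousValuation X} (hν : ν.IsBounded)
    (c : Finset ι → ℝ≥0) {𝒮 : Finset (Finset ι)} (h𝒮 : IsUpperSet (𝒮 : Set (Finset ι))) :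
    cellCombination hν O c (cellUnion O 𝒮) = (∑ S ∈ 𝒮, c S * ν.cellMass O S : ℝ≥0) := by
  rw [cellCombination_apply, ENNReal.ofNNReal_finsetSum,
    ← Finset.sum_subset (Finset.subset_univ 𝒮)]
  · refine Finset.sum_congr rfl fun S hS => ?_
    rw [ENNReal.coe_mul, coe_cellMass hν, inf_eq_right.2]
    exact le_iSup₂_of_le S hS le_rfl
  · intro S _ hS
    have hle : cellUnion O 𝒮 ⊓ cellInf O S ≤ cellSup O S := by
      rintro x ⟨hx, -⟩
      obtain ⟨T, hT, hxT⟩ := mem_cellUnion.1 hx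
      obtain ⟨i, hiT, hiS⟩ := Finset.not_subset.1 fun hTS => hS (h𝒮 hTS hT)
      exact mem_cellSup.2 ⟨i, hiS, mem_cellInf.1 hxT i hiT⟩
    rw [crescentMass, sup_eq_right.2 hle, tsub_self, mul_zero]

/-- The hypothesis forces a coefficient at most `1` on cells of positive mass; on null cells the
coefficient is irrelevant. -/
theorem cellCombination_le {ν : ContinuousValuation X} (hν : ν.IsBounded)
    {c : Finset ι → ℝ≥0} (hc : ∀ S, c S * ν.cellMass O S ≤ ν.cellMass O S) :
    cellCombination hν O c ≤ ν := by
  refine le_iff.2 fun W => ?_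
  have h := sum_crescentMass (O := O) hν W Finset.univ (by simpa using isUpperSet_univ)
  rw [cellUnion_univ, inf_top_eq] at h
  rw [cellCombination_apply, ← h]
  refine Finset.sum_le_sum fun S _ => ?_
  have hle : ν.crescentMass (W ⊓ cellInf O S) (cellSup O S) ≤ ν.cellMass O S := by
    rw [coe_cellMass hν]
    exact tsub_le_tsub_right (ν.mono (sup_le_sup_right inf_le_right _)) _
  rcases eq_or_ne (ν.cellMass O S) 0 with h0 | h0
  · rw [h0, ENNReal.coe_zero, nonpos_iff_eq_zero] at hle
    simp [hle]
  · have : c S ≤ 1 :=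
      le_of_mul_le_mul_right ((hc S).trans_eq (one_mul _).symm) (pos_iff_ne_zero.2 h0)
    exact (mul_le_mul_left (by exact_mod_cast this) _).trans_eq (one_mul _)

theorem constriction_smul {ν : ContinuousValuation X} (hν : ν.IsBounded) (r : ℝ≥0)
    (U V : Opens X) : (r • ν).constriction (hν.smul r) U V = r • ν.constriction hν U V :=
  DFunLike.ext _ _ fun _ => (ENNReal.mul_sub fun _ _ => ENNReal.coe_ne_top).symm

theorem isCrescentCombination_smul_cellCombination {ν : ContinuousValuation X} (hν : ν.IsBounded)
    (c : Finset ι → ℝ≥0) (a : ℝ≥0) {r : ℝ≥0} (hr : r ≠ 0) :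
    (a • cellCombination hν O c).IsCrescentCombination (r • ν) (hν.smul r) := by
  let e := (Fintype.equivFin (Finset ι)).symm
  refine ⟨_, fun i => cellInf O (e i), fun i => cellSup O (e i), fun i => a * c (e i) * r⁻¹,
    fun i j hij => disjoint_cells (e.injective.ne hij), ?_⟩
  rw [e.sum_comp fun S => (a * c S * r⁻¹) • (r • ν).constriction _ (cellInf O S) (cellSup O S),
    cellCombination, Finset.smul_sum]
  refine Finset.sum_congr rfl fun S _ => ?_
  rw [constriction_smul hν, smul_smul, smul_smul, inv_mul_cancel_right₀ hr]

/-- If `ν` dominates `μ + ϖ` on the unions of the cells, then it dominates a sum of two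
combinations of its constrictions to the cells, with the total mass of `μ` and of `ϖ`, and which
dominate `μ` and `ϖ` on the given open sets. -/
theorem exists_cellCombination {μ ϖ ν : ContinuousValuation X} (hμ : μ.IsBounded)
    (hϖ : ϖ.IsBounded) (hν : ν.IsBounded) (O : ι → Opens X)
    (h : ∀ 𝒮, (μ + ϖ) (cellUnion O 𝒮) ≤ ν (cellUnion O 𝒮)) :
    ∃ c d : Finset ι → ℝ≥0, cellCombination hν O c + cellCombination hν O d ≤ ν ∧
      (cellCombination hν O c ⊤ = μ ⊤ ∧ ∀ i, μ (O i) ≤ cellCombination hν O c (O i)) ∧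
      (cellCombination hν O d ⊤ = ϖ ⊤ ∧ ∀ i, ϖ (O i) ≤ cellCombination hν O d (O i)) := by
  classical
  -- The preorder is inclusion of cell indices, and each upper set of indices corresponds to the
  -- open set `cellUnion O 𝒮`.
  obtain ⟨u, v, huv, hu, hv, hS⟩ := exists_splitting (μ.cellMass O) (ϖ.cellMass O) (ν.cellMass O)
    fun 𝒮 h𝒮 => by
      rw [Finset.sum_add_distrib, ← ENNReal.coe_le_coe, ENNReal.coe_add, sum_cellMass hμ h𝒮,
        sum_cellMass hϖ h𝒮, sum_cellMass hν h𝒮]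
      exact h 𝒮
  have key : ∀ w : Finset ι → ℝ≥0, (∀ S, w S ≤ ν.cellMass O S) →
      ∀ S, w S / ν.cellMass O S * ν.cellMass O S = w S := fun w hw S =>
    -- On a null cell nothing has arrived either, so the default value `0 / 0 = 0` is the right one.
    div_mul_cancel_of_imp fun h0 => nonpos_iff_eq_zero.1 ((hw S).trans_eq h0)
  have hu' := key u fun S => le_self_add.trans (huv S)
  have hv' := key v fun S => le_add_self.trans (huv S)
  have htop : IsUpperSet ((Finset.univ : Finset (Finset ι)) : Set (Finset ι)) := by
    simpa using isUpperSet_univ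
  have hi : ∀ i : ι, IsUpperSet
      ((Finset.univ.filter (i ∈ ·) : Finset (Finset ι)) : Set (Finset ι)) := by
    intro i A B hAB hA
    simp only [Finset.coe_filter, Finset.mem_univ, true_and, mem_ofPred_eq] at hA ⊢
    exact hAB hA
  refine ⟨fun S => u S / ν.cellMass O S, fun S => v S / ν.cellMass O S, ?_, ⟨?_, fun i => ?_⟩,
    ⟨?_, fun i => ?_⟩⟩
  · have e : cellCombination hν O (fun S => u S / ν.cellMass O S) +
        cellCombination hν O (fun S => v S / ν.cellMass O S) =
        cellCombination hν O fun S => u S / ν.cellMass O S + v S / ν.cellMass O S := by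
      simp only [cellCombination, add_smul, Finset.sum_add_distrib]
    rw [e]
    refine cellCombination_le hν fun S => ?_
    rw [add_mul, hu', hv']
    exact huv S
  · rw [← cellUnion_univ (O := O), cellCombination_cellUnion hν _ htop, ← sum_cellMass hμ htop]
    simp only [hu', hu]
  · rw [← cellUnion_filter_mem (O := O) i, cellCombination_cellUnion hν _ (hi i),
      ← sum_cellMass hμ (hi i)]
    simp only [hu']
    exact_mod_cast (hS _ (hi i)).1
  · rw [← cellUnion_univ (O := O), cellCombination_cellUnion hν _ htop, ← sum_cellMass hϖ htop]
    simp only [hv', hv]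
  · rw [← cellUnion_filter_mem (O := O) i, cellCombination_cellUnion hν _ (hi i),
      ← sum_cellMass hϖ (hi i)]
    simp only [hv']
    exact_mod_cast (hS _ (hi i)).2

end Cells

/-! ### The criterion -/

/-- Strong consistency of a set `B` of continuous valuations, stated inside the ambient cone: if
`ν` dominates a combination of elements of `B ∩ U` and `B ∩ V`, so do all elements of `B` near
`ν`. -/
def CombinationsOpenIn (B : Set (ContinuousValuation X)) : Prop :=
  ∀ (U V : Set (ContinuousValuation X)) (a b : ℝ≥0), IsOpen U → IsOpen V → 0 < a → 0 < b →
    a + b = 1 → ∀ μ ∈ B ∩ U, ∀ ϖ ∈ B ∩ V, ∀ ν ∈ B, a • μ + b • ϖ ≤ ν →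
      ∃ W, IsOpen W ∧ ν ∈ W ∧ ∀ ν' ∈ B ∩ W, ∃ μ' ∈ B ∩ U, ∃ ϖ' ∈ B ∩ V, a • μ' + b • ϖ' ≤ ν'

/-- The core of the criterion. The factor `s < 1` leaves the room that makes the required
inequalities an open condition on `ν'`; hypothesis (ii) keeps `s • μ` and `s • ϖ` in `B`, to serve
as mass references in (iii). -/
theorem combinationsOpenIn_of_crescentCombination {B : Set (ContinuousValuation X)}
    (hsup : ∀ ν ∈ B, ∃ D : Set (ContinuousValuation X),
      D ⊆ B ∩ bounded X ∧ D.Nonempty ∧ DirectedOn (· ≤ ·) D ∧ IsLUB D ν)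
    (hsmul : ∀ μ ∈ B ∩ bounded X, ∀ c : ℝ≥0, 0 < c → c < 1 → c • μ ∈ B)
    (hcomb : ∀ μ ∈ B ∩ bounded X, ∀ ϖ ∈ B, ∀ hϖ : ϖ.IsBounded, ∀ r : ℝ≥0, 1 < r →
      ∀ μ' : ContinuousValuation X, μ'.IsCrescentCombination (r • ϖ) (hϖ.smul r) →
        μ ⊤ = μ' ⊤ → μ' ∈ B) :
    CombinationsOpenIn B := by
  have happrox : ∀ ν ∈ B, ∀ W, IsOpen W → ν ∈ W →
      ∃ ν₀ ∈ B, ν₀.IsBounded ∧ ν₀ ∈ W ∧ ν₀ ≤ ν := by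
    intro ν hν W hW hνW
    obtain ⟨D, hDB, hne, hD, hlub⟩ := hsup ν hν
    obtain ⟨ν₀, h0, h0W⟩ := exists_mem_of_isLUB hne hD hlub hW hνW
    exact ⟨ν₀, (hDB h0).1, (hDB h0).2, h0W, hlub.1 h0⟩
  intro U V a b hU hV ha hb _ μ₁ hμ₁ ϖ₁ hϖ₁ ν hν hle₁
  obtain ⟨μ, hμB, hμ, hμU, hμle⟩ := happrox μ₁ hμ₁.1 U hU hμ₁.2
  obtain ⟨ϖ, hϖB, hϖ, hϖV, hϖle⟩ := happrox ϖ₁ hϖ₁.1 V hV hϖ₁.2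
  have hle : a • μ + b • ϖ ≤ ν := fun O =>
    (add_le_add (mul_le_mul_right (hμle O) _) (mul_le_mul_right (hϖle O) _)).trans (hle₁ O)
  obtain ⟨F₁, s₁, hF₁, h01, h11, H₁⟩ := exists_finset_of_mem_isOpen hU hμU
  obtain ⟨F₂, s₂, hF₂, h02, h12, H₂⟩ := exists_finset_of_mem_isOpen hV hϖV
  set s := max s₁ s₂ with hs
  have hs0 : 0 < s := lt_max_of_lt_left h01
  have hs1 : s < 1 := max_lt h11 h12
  set F := F₁ ∪ F₂ with hF
  have : Fintype F := (hF₁.union hF₂).fintype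
  let O : F → Opens X := Subtype.val
  set ξ := a • μ + b • ϖ with hξ
  have hξb : ξ.IsBounded := ENNReal.add_lt_top.2 ⟨hμ.smul a, hϖ.smul b⟩
  -- A strict inequality is open, but could fail where `ξ` vanishes; there the weak inequality
  -- needed later is trivial.
  refine ⟨{ν' | ∀ 𝒮, ξ (cellUnion O 𝒮) ≠ 0 → s * ξ (cellUnion O 𝒮) < ν' (cellUnion O 𝒮)}, ?_, ?_,
    ?_⟩
  · simp only [ofPred_forall]
    exact isOpen_iInter_of_finite fun 𝒮 => isOpen_iInter_of_finite fun _ => isOpen_lt _ _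
  · intro 𝒮 h0
    refine lt_of_lt_of_le ?_ (hle _)
    have h := ENNReal.mul_lt_mul_left h0 (hξb.ne_top (cellUnion O 𝒮))
      (ENNReal.coe_lt_coe.2 hs1)
    simpa using h
  · rintro ν₁ ⟨hν₁B, hν₁⟩
    -- Constrictions require a bounded valuation, so `ν₁` is replaced by a bounded element of `B`
    -- below it in the same neighborhood.
    obtain ⟨ν', hν'B, hν', hν'W, hν'le⟩ := happrox ν₁ hν₁B _ (by
      simp only [ofPred_forall]
      exact isOpen_iInter_of_finite fun 𝒮 => isOpen_iInter_of_finite fun _ => isOpen_lt _ _) hν₁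
    obtain ⟨c, d, hcd, ⟨hcT, hcO⟩, hdT, hdO⟩ := exists_cellCombination
      ((hμ.smul s).smul a) ((hϖ.smul s).smul b) hν' O fun 𝒮 => by
        rw [smul_comm a, smul_comm b, ← smul_add, ← hξ, smul_apply]
        rcases eq_or_ne (ξ (cellUnion O 𝒮)) 0 with h0 | h0
        · simp [h0]
        · exact (hν'W 𝒮 h0).le
    -- Any scale above `1` would do, since the coefficients of the combination absorb it.
    have hr : (1 : ℝ≥0) < 2 := by norm_num
    have ha' : ∀ ζ : ContinuousValuation X, a⁻¹ • a • ζ = ζ := fun ζ => inv_smul_smul₀ ha.ne' ζ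
    have hb' : ∀ ζ : ContinuousValuation X, b⁻¹ • b • ζ = ζ := fun ζ => inv_smul_smul₀ hb.ne' ζ
    refine ⟨a⁻¹ • cellCombination hν' O c, ⟨?_, H₁ _ fun A hA => ?_⟩,
      b⁻¹ • cellCombination hν' O d, ⟨?_, H₂ _ fun A hA => ?_⟩, ?_⟩
    · refine hcomb (s • μ) ⟨hsmul μ ⟨hμB, hμ⟩ s hs0 hs1, hμ.smul s⟩ ν' hν'B hν' 2 hr _
        (isCrescentCombination_smul_cellCombination hν' c _ two_ne_zero) ?_
      rw [smul_apply a⁻¹, hcT, ← smul_apply, ha']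
    · have h := hcO ⟨A, Or.inl hA⟩
      have h2 : (a⁻¹ : ℝ≥0) * (a • s • μ) A ≤ (a⁻¹ : ℝ≥0) * cellCombination hν' O c A :=
        mul_le_mul_right h _
      rw [← smul_apply, ha', smul_apply] at h2
      refine le_trans (mul_le_mul_left ?_ _) h2
      exact_mod_cast le_max_left s₁ s₂
    · refine hcomb (s • ϖ) ⟨hsmul ϖ ⟨hϖB, hϖ⟩ s hs0 hs1, hϖ.smul s⟩ ν' hν'B hν' 2 hr _
        (isCrescentCombination_smul_cellCombination hν' d _ two_ne_zero) ?_
      rw [smul_apply b⁻¹, hdT, ← smul_apply, hb']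
    · have h := hdO ⟨A, Or.inr hA⟩
      have h2 : (b⁻¹ : ℝ≥0) * (b • s • ϖ) A ≤ (b⁻¹ : ℝ≥0) * cellCombination hν' O d A :=
        mul_le_mul_right h _
      rw [← smul_apply, hb', smul_apply] at h2
      refine le_trans (mul_le_mul_left ?_ _) h2
      exact_mod_cast le_max_right s₁ s₂
    · rw [smul_inv_smul₀ ha.ne', smul_inv_smul₀ hb.ne']
      exact hcd.trans hν'le

end ContinuousValuation

/-! ### General facts on consistency and upward closure -/

theorem IsStronglyConsistent.isConsistent {B : Type*} [BarycentricAlgebra B] [TopologicalSpace B]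
    (h : IsStronglyConsistent B) : IsConsistent B := by
  intro U V J hU hV _
  have e : upClosure {z : B | ∃ a ∈ J, ∃ x ∈ U, ∃ y ∈ V, bary a x y = z}
      = ⋃ a ∈ J, upClosure {z | ∃ x ∈ U, ∃ y ∈ V, bary a x y = z} := by
    ext w
    simp only [upClosure, mem_iUnion, mem_ofPred_eq]
    exact ⟨fun ⟨z, ⟨a, ha, hz⟩, hw⟩ => ⟨a, ha, z, hz, hw⟩,
      fun ⟨a, ha, z, hz, hw⟩ => ⟨z, ⟨a, ha, hz⟩, hw⟩⟩
  rw [e]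
  exact isOpen_biUnion fun a _ => h U V a hU hV

theorem upClosure_eq_of_isOpen {B : Type*} [TopologicalSpace B] {U : Set B} (hU : IsOpen U) :
    upClosure U = U :=
  Subset.antisymm (fun _ ⟨_, hx, h⟩ => specializes_iff_forall_open.1 h U hU hx)
    fun x hx => ⟨x, hx, specializes_rfl⟩

namespace ContinuousValuation

variable {X : Type*} [TopologicalSpace X]

/-! ### Transfer to barycentric algebras and cones -/

/-- Stated for an inducing map so as to cover convex subsets, subcones and the full cone at once. -/
theorem CombinationsOpenIn.isStronglyConsistent {B : Type*} [BarycentricAlgebra B]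
    [TopologicalSpace B] {f : B → ContinuousValuation X} (hf : IsInducing f)
    (hbary : ∀ a x y, f (bary a x y) =
      unitInterval.toNNReal a • f x + unitInterval.toNNReal (σ a) • f y)
    (h : CombinationsOpenIn (range f)) : IsStronglyConsistent B := by
  -- `CombinationsOpenIn` needs two positive weights. At an endpoint the combination is one of the
  -- two open sets, or empty if the other one is.
  have key : ∀ U V : Set B, IsOpen U → IsOpen V →
      IsOpen (upClosure {z | ∃ x ∈ U, ∃ y ∈ V, bary 1 x y = z}) := by
    intro U V hU hV
    rcases V.eq_empty_or_nonempty with rfl | ⟨y, hy⟩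
    · simp [upClosure]
    · have : {z | ∃ x ∈ U, ∃ y ∈ V, bary 1 x y = z} = U := by
        ext z
        simp only [bary_one, mem_ofPred_eq]
        exact ⟨fun ⟨x, hx, _, _, hxz⟩ => hxz ▸ hx, fun hz => ⟨z, hz, y, hy, rfl⟩⟩
      rwa [this, upClosure_eq_of_isOpen hU]
  intro U V a hU hV
  rcases eq_or_ne a 1 with rfl | h1
  · exact key U V hU hV
  rcases eq_or_ne a 0 with rfl | h0
  · convert key V U hV hU using 3
    ext z
    have e : ∀ x y : B, bary 0 x y = bary 1 y x := fun x y => by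
      rw [bary_symm 0, unitInterval.symm_zero]
    simp only [e]
    exact ⟨fun ⟨x, hx, y, hy, h⟩ => ⟨y, hy, x, hx, h⟩, fun ⟨y, hy, x, hx, h⟩ => ⟨x, hx, y, hy, h⟩⟩
  obtain ⟨U, hU', rfl⟩ := hf.isOpen_iff.1 hU
  obtain ⟨V, hV', rfl⟩ := hf.isOpen_iff.1 hV
  refine isOpen_iff_forall_mem_open.2 ?_
  rintro w ⟨_, ⟨x, hx, y, hy, rfl⟩, hw⟩
  rw [← hf.specializes_iff, specializes_iff, hbary] at hw
  obtain ⟨W, hW, hwW, H⟩ := h U V (unitInterval.toNNReal a) (unitInterval.toNNReal (σ a)) hU' hV'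
    (unitInterval.pos_iff_ne_zero.2 h0)
    (unitInterval.pos_iff_ne_zero.2 fun h => h1 (unitInterval.symm_eq_zero.1 h))
    (unitInterval.toNNReal_add_toNNReal_symm a) (f x) ⟨⟨x, rfl⟩, hx⟩ (f y) ⟨⟨y, rfl⟩, hy⟩
    (f w) ⟨w, rfl⟩ hw
  refine ⟨f ⁻¹' W, fun w' hw' => ?_, hW.preimage hf.continuous, hwW⟩
  obtain ⟨_, ⟨⟨x', rfl⟩, hx'⟩, _, ⟨⟨y', rfl⟩, hy'⟩, hle⟩ := H (f w') ⟨⟨w', rfl⟩, hw'⟩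
  refine ⟨_, ⟨x', hx', y', hy', rfl⟩, ?_⟩
  rwa [← hf.specializes_iff, specializes_iff, hbary]

theorem CombinationsOpenIn.isStronglyConsistentTopologicalSubalgebra
    {B : Set (ContinuousValuation X)} (h : CombinationsOpenIn B) (hB : Convex ℝ≥0 B) :
    IsStronglyConsistentTopologicalSubalgebra B := by
  refine ⟨hB, ?_, ?_⟩
  · have hcont : Continuous fun a : I => ((unitInterval.toNNReal a : ℝ≥0) : ℝ≥0∞) :=
      ENNReal.continuous_coe.comp unitInterval.toNNReal_continuous
    refine Continuous.subtype_mk (continuous_iff.2 fun U => ?_) _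
    have hev : LowerSemicontinuous fun ν : B => ν.1 U :=
      (lowerSemicontinuous_eval U).comp continuous_subtype_val
    exact ((hcont.comp (continuous_fst.comp continuous_snd)).lowerSemicontinuous.ennreal_mul
      (hev.comp continuous_fst)).add
      ((hcont.comp (unitInterval.continuous_symm.comp
        (continuous_fst.comp continuous_snd))).lowerSemicontinuous.ennreal_mul
      (hev.comp (continuous_snd.comp continuous_snd)))
  · refine @CombinationsOpenIn.isStronglyConsistent X _ B (BarycentricAlgebra.ofConvex hB) _
      Subtype.val IsInducing.subtypeVal (fun _ _ _ => rfl) ?_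
    rwa [Subtype.range_coe]

theorem CombinationsOpenIn.isConsistentTopologicalSubcone
    (S : Submodule ℝ≥0 (ContinuousValuation X))
    (h : CombinationsOpenIn (S : Set (ContinuousValuation X))) :
    IsConsistentTopologicalSubcone (S : Set (ContinuousValuation X)) := by
  refine ⟨S, rfl, ⟨?_, ?_⟩, ?_⟩
  · exact (isTopologicalCone.continuous_add.comp ((continuous_subtype_val.comp continuous_fst).prodMk
      (continuous_subtype_val.comp continuous_snd))).subtype_mk _
  · exact (isTopologicalCone.continuous_smul.comp (continuous_fst.prodMk
      (continuous_subtype_val.comp continuous_snd))).subtype_mk _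
  · let _ := BarycentricAlgebra.ofCone S
    refine IsStronglyConsistent.isConsistent (CombinationsOpenIn.isStronglyConsistent
      (f := Subtype.val) IsInducing.subtypeVal (fun _ _ _ => rfl) ?_)
    rwa [Subtype.range_coe]

theorem CombinationsOpenIn.isConsistentTopologicalCone
    (h : CombinationsOpenIn (univ : Set (ContinuousValuation X))) :
    IsConsistentTopologicalCone (ContinuousValuation X) := by
  refine ⟨isTopologicalCone, ?_⟩
  let _ := BarycentricAlgebra.ofCone (ContinuousValuation X)
  refine IsStronglyConsistent.isConsistent (CombinationsOpenIn.isStronglyConsistent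
    (f := id) IsInducing.id (fun _ _ _ => rfl) ?_)
  rwa [range_id]

/-! ### Bounded approximations -/

/-- The restriction of a continuous valuation to an open set. -/
def restrict (ν : ContinuousValuation X) (U : Opens X) : ContinuousValuation X where
  toFun W := ν (W ⊓ U)
  strict' := by rw [bot_inf_eq, bot_apply]
  modular' W W' := by rw [modular, ← inf_sup_right, ← inf_inf_distrib_right]
  scott' := by
    rw [scottContinuous_ennreal_iff]
    refine ⟨fun W W' h => ν.mono (inf_le_inf_right _ h), fun d hne hd a ha => ?_⟩
    have hdir : DirectedOn (· ≤ ·) ((· ⊓ U) '' d) := by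
      rintro _ ⟨W, hW, rfl⟩ _ ⟨W', hW', rfl⟩
      obtain ⟨Z, hZ, h1, h2⟩ := hd W hW W' hW'
      exact ⟨_, ⟨Z, hZ, rfl⟩, inf_le_inf_right _ h1, inf_le_inf_right _ h2⟩
    rw [← ha.sSup_eq, sSup_inf_eq, ← sSup_image, ν.iSup_directed (hne.image _) hdir]
    simp only [iSup_subtype, iSup_image]

theorem dirac_apply_of_mem {x : X} {U : Opens X} (h : x ∈ U) : dirac x U = 1 := if_pos h

theorem dirac_apply_of_notMem {x : X} {U : Opens X} (h : x ∉ U) : dirac x U = 0 := if_neg h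

open Classical in
/-- Every continuous valuation is the directed supremum of sums of its restrictions to open sets
of finite mass and of simple valuations. -/
theorem exists_directed_approximation (ν : ContinuousValuation X) :
    ∃ D : Set (ContinuousValuation X), D.Nonempty ∧ DirectedOn (· ≤ ·) D ∧ IsLUB D ν ∧
      ∀ μ ∈ D, ∃ (U : Opens X) (A : Finset X) (n : ℝ≥0), ν U < ∞ ∧
        μ = ν.restrict U + ∑ x ∈ A, n • dirac x := by
  let g : Opens X → Finset X → ℝ≥0 → ContinuousValuation X := fun U A n =>
    ν.restrict U + ∑ x ∈ A, n • dirac x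
  -- The points of `A` lie in no open set of finite mass, so the Dirac terms only affect open sets
  -- where `ν` is infinite. There they can supply the infinite mass that restrictions to sets of
  -- finite mass cannot see.
  let D : Set (ContinuousValuation X) := {μ | ∃ (U : Opens X) (A : Finset X) (n : ℝ≥0), ν U < ∞ ∧
    (∀ x ∈ A, ∀ V : Opens X, ν V < ∞ → x ∉ V) ∧ μ = g U A n}
  have hg : ∀ U A n W, g U A n W = ν (W ⊓ U) + ∑ x ∈ A, n * dirac x W := fun U A n W => by
    rw [add_apply, sum_apply]; rfl
  have hmono : ∀ {U U' A A'} {n n' : ℝ≥0}, U ≤ U' → A ⊆ A' → n ≤ n' → g U A n ≤ g U' A' n' := by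
    intro U U' A A' n n' hU hA hn
    refine le_iff.2 fun W => ?_
    rw [hg, hg]
    refine add_le_add (ν.mono (inf_le_inf_left _ hU)) ((Finset.sum_le_sum fun x _ =>
      mul_le_mul_left (ENNReal.coe_le_coe.2 hn) _).trans (Finset.sum_le_sum_of_subset hA))
  have hunion : ∀ {U V : Opens X}, ν U < ∞ → ν V < ∞ → ν (U ⊔ V) < ∞ := fun {U V} hU hV =>
    lt_of_le_of_lt (by rw [modular]; exact le_self_add) (ENNReal.add_lt_top.2 ⟨hU, hV⟩)
  have hbot : ν ⊥ < ∞ := by rw [bot_apply]; exact ENNReal.zero_lt_top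
  have hdir : DirectedOn (· ≤ ·) D := by
    rintro _ ⟨U, A, n, hU, hA, rfl⟩ _ ⟨U', A', n', hU', hA', rfl⟩
    refine ⟨_, ⟨U ⊔ U', A ∪ A', max n n', hunion hU hU', fun x hx => ?_, rfl⟩,
      hmono le_sup_left Finset.subset_union_left (le_max_left _ _),
      hmono le_sup_right Finset.subset_union_right (le_max_right _ _)⟩
    exact (Finset.mem_union.1 hx).elim (hA x) (hA' x)
  refine ⟨D, ⟨_, ⊥, ∅, 0, hbot, by simp, rfl⟩, hdir, (isLUB_iff hdir).2 fun W => ?_,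
    fun μ ⟨U, A, n, hU, _, h⟩ => ⟨U, A, n, hU, h⟩⟩
  apply le_antisymm
  · by_cases hW : ∀ x ∈ W, ∃ V : Opens X, ν V < ∞ ∧ x ∈ V
    · have hs : sSup {V : Opens X | V ≤ W ∧ ν V < ∞} = W := by
        refine le_antisymm (sSup_le fun V hV => hV.1) fun x hx => ?_
        obtain ⟨V, hV, hxV⟩ := hW x hx
        exact Opens.mem_sSup.2
          ⟨V ⊓ W, ⟨inf_le_right, (ν.mono inf_le_left).trans_lt hV⟩, hxV, hx⟩
      have hsup := ν.iSup_directed (d := {V : Opens X | V ≤ W ∧ ν V < ∞}) ⟨⊥, bot_le, hbot⟩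
        fun U hU V hV => ⟨U ⊔ V, ⟨sup_le hU.1 hV.1, hunion hU.2 hV.2⟩, le_sup_left, le_sup_right⟩
      rw [← hs, hsup, hs]
      refine iSup_le fun V => le_iSup_of_le
        (⟨g V ∅ 0, V, ∅, 0, V.2.2, by simp, rfl⟩ : D) ?_
      rw [hg, inf_eq_right.2 V.2.1]
      exact le_self_add
    · push Not at hW
      obtain ⟨x, hxW, hx⟩ := hW
      refine le_top.trans ?_
      rw [← ENNReal.iSup_natCast]
      refine iSup_le fun n => le_iSup_of_le
        (⟨g ⊥ {x} n, ⊥, {x}, n, hbot, by simpa using hx, rfl⟩ : D) ?_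
      rw [hg, Finset.sum_singleton, dirac_apply_of_mem hxW, mul_one]
      exact_mod_cast le_add_self
  · refine iSup_le ?_
    rintro ⟨_, U, A, n, hU, hA, rfl⟩
    rcases eq_top_or_lt_top (ν W) with h | h
    · rw [h]; exact le_top
    · rw [hg, Finset.sum_eq_zero fun x hx => by
        rw [dirac_apply_of_notMem (hA x hx W h), mul_zero], add_zero]
      exact ν.mono inf_le_left

/-! ### Cones of valuations that are closed under constriction -/

/-- A cone of valuations is closed under constriction if it contains the constrictions of its
bounded elements to all crescents. -/
def ConstrictionClosed (S : Submodule ℝ≥0 (ContinuousValuation X)) : Prop :=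
  ∀ ν ∈ S, ∀ (hν : ν.IsBounded) (U V : Opens X), ν.constriction hν U V ∈ S

theorem ConstrictionClosed.mem_of_isCrescentCombination
    {S : Submodule ℝ≥0 (ContinuousValuation X)} (hS : ConstrictionClosed S)
    {ν ξ : ContinuousValuation X} (hν : ν.IsBounded) (hνS : ν ∈ S)
    (h : ξ.IsCrescentCombination ν hν) : ξ ∈ S := by
  obtain ⟨n, U, V, a, -, rfl⟩ := h
  exact sum_mem fun i _ => S.smul_mem _ (hS ν hνS hν _ _)

/-- In a cone hypothesis (ii) is automatic, and closure under constriction gives (iii) whatever the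
total mass. -/
theorem ConstrictionClosed.combinationsOpenIn {S : Submodule ℝ≥0 (ContinuousValuation X)}
    (hS : ConstrictionClosed S)
    (hsup : ∀ ν ∈ S, ∃ D : Set (ContinuousValuation X),
      D ⊆ S ∩ bounded X ∧ D.Nonempty ∧ DirectedOn (· ≤ ·) D ∧ IsLUB D ν) :
    CombinationsOpenIn (S : Set (ContinuousValuation X)) :=
  combinationsOpenIn_of_crescentCombination hsup (fun _ hμ c _ _ => S.smul_mem c hμ.1)
    fun _ _ _ hϖS hϖ r _ _ h _ =>
      hS.mem_of_isCrescentCombination (hϖ.smul r) (S.smul_mem r hϖS) h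

theorem exists_directed_of_isBounded {B : Set (ContinuousValuation X)} {ν : ContinuousValuation X}
    (hν : ν ∈ B) (hb : ν.IsBounded) : ∃ D : Set (ContinuousValuation X),
      D ⊆ B ∩ bounded X ∧ D.Nonempty ∧ DirectedOn (· ≤ ·) D ∧ IsLUB D ν :=
  ⟨{ν}, singleton_subset_iff.2 ⟨hν, hb⟩, singleton_nonempty ν, directedOn_singleton ν,
    isLUB_singleton⟩

theorem isBounded_of_mem_subprobability {ν : ContinuousValuation X} (h : ν ∈ subprobability X) :
    ν.IsBounded := lt_of_le_of_lt h ENNReal.one_lt_top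

/-- Here the equality of total masses in (iii) matters: it keeps the combination of mass at most
`1`. -/
theorem ConstrictionClosed.combinationsOpenIn_subprobability
    {S : Submodule ℝ≥0 (ContinuousValuation X)} (hS : ConstrictionClosed S) :
    CombinationsOpenIn (subprobability X ∩ S) := by
  refine combinationsOpenIn_of_crescentCombination
    (fun ν hν => exists_directed_of_isBounded hν (isBounded_of_mem_subprobability hν.1))
    (fun μ hμ c _ hc => ⟨?_, S.smul_mem c hμ.1.2⟩)
    fun μ hμ ϖ hϖS hϖ r _ ξ h hξ => ⟨(hξ.symm.trans_le hμ.1.1 : ξ ⊤ ≤ 1),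
      hS.mem_of_isCrescentCombination (hϖ.smul r) (S.smul_mem r hϖS.2) h⟩
  exact mul_le_one' (ENNReal.coe_le_coe.2 hc.le) (show μ ⊤ ≤ 1 from hμ.1.1)

theorem convex_subprobability : Convex ℝ≥0 (subprobability X) := by
  intro μ hμ ν hν a b _ _ hab
  change (a : ℝ≥0∞) * μ ⊤ + b * ν ⊤ ≤ 1
  calc (a : ℝ≥0∞) * μ ⊤ + b * ν ⊤ ≤ a * 1 + b * 1 :=
      add_le_add (mul_le_mul_right hμ _) (mul_le_mul_right hν _)
    _ = 1 := by rw [mul_one, mul_one]; exact_mod_cast hab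

theorem convex_probability : Convex ℝ≥0 (probability X) := by
  intro μ hμ ν hν a b _ _ hab
  change (a : ℝ≥0∞) * μ ⊤ + b * ν ⊤ = 1
  rw [show μ ⊤ = 1 from hμ, show ν ⊤ = 1 from hν, mul_one, mul_one]
  exact_mod_cast hab

theorem eq_top_of_mem {bot : X} (hbot : ∀ x, x ⤳ bot) {U : Opens X} (h : bot ∈ U) : U = ⊤ :=
  top_unique fun x _ => (hbot x).mem_open U.isOpen h

/-- On a pointed space, the missing mass of a subprobability valuation can be placed at the least
element. -/
theorem CombinationsOpenIn.probability {S : Submodule ℝ≥0 (ContinuousValuation X)}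
    (h : CombinationsOpenIn (subprobability X ∩ S)) {bot : X} (hbot : ∀ x, x ⤳ bot)
    (hS : dirac bot ∈ S) : CombinationsOpenIn (probability X ∩ S) := by
  have hsub : ∀ {T : Set _}, (ContinuousValuation.probability X ∩ S) ∩ T ⊆ (subprobability X ∩ S) ∩ T :=
    fun {T} _ hν => ⟨⟨le_of_eq hν.1.1, hν.1.2⟩, hν.2⟩
  let fill : ContinuousValuation X → ContinuousValuation X := fun μ =>
    μ + (1 - μ ⊤).toNNReal • dirac bot
  have hfill : ∀ {T} (_ : IsOpen T), ∀ μ ∈ (subprobability X ∩ (S : Set _)) ∩ T,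
      fill μ ∈ (ContinuousValuation.probability X ∩ (S : Set _)) ∩ T := by
    rintro T hT μ ⟨⟨hμ, hμS⟩, hμT⟩
    refine ⟨⟨?_, S.add_mem hμS (S.smul_mem _ hS)⟩, mem_of_le hT (fun O => le_self_add) hμT⟩
    change μ ⊤ + ((1 - μ ⊤).toNNReal : ℝ≥0∞) * dirac bot ⊤ = 1
    rw [dirac_apply_of_mem (Opens.mem_top bot), mul_one, ENNReal.coe_toNNReal (by simp),
      add_tsub_cancel_of_le (show μ ⊤ ≤ 1 from hμ)]
  intro U V a b hU hV ha hb hab μ hμ ϖ hϖ ν hν hle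
  obtain ⟨W, hW, hνW, H⟩ := h U V a b hU hV ha hb hab μ (hsub hμ) ϖ (hsub hϖ) ν
    ⟨le_of_eq hν.1, hν.2⟩ hle
  refine ⟨W, hW, hνW, fun ν' hν' => ?_⟩
  obtain ⟨μ', hμ', ϖ', hϖ', hle'⟩ := H ν' (hsub hν')
  have hμ'' := hfill hU μ' hμ'
  have hϖ'' := hfill hV ϖ' hϖ'
  refine ⟨fill μ', hμ'', fill ϖ', hϖ'', le_iff.2 fun O => ?_⟩
  -- Filling changes values only on open sets containing `bot`, that is, only on `⊤`, where both
  -- sides have mass `1`.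
  by_cases hO : bot ∈ O
  · rw [eq_top_of_mem hbot hO, show ν' ⊤ = 1 from hν'.1.1]
    exact (convex_probability hμ''.1.1 hϖ''.1.1 zero_le zero_le hab).le
  · have e : ∀ ξ, fill ξ O = ξ O := fun ξ => by
      rw [add_apply, smul_apply, dirac_apply_of_notMem hO, mul_zero, add_zero]
    rw [add_apply, smul_apply, smul_apply, e, e]
    exact hle' O

/-! ### Point-continuous, bounded and simple valuations -/

theorem isPointContinuous_iff {ν : ContinuousValuation X} :
    ν.IsPointContinuous ↔ @LowerSemicontinuous _ _ (pointwiseTopology X) _ ν :=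
  @continuous_toScott_iff _ (pointwiseTopology X) ν

theorem isPointContinuous_dirac (x : X) : (dirac x).IsPointContinuous := by
  let _ := pointwiseTopology X
  refine isPointContinuous_iff.2 fun U c hc => ?_
  have ho : IsOpen {U : Opens X | x ∈ U} := isOpen_generateFrom_of_mem ⟨x, rfl⟩
  have hU : x ∈ U := by
    by_contra h
    change c < dirac x U at hc
    rw [dirac_apply_of_notMem h] at hc
    exact not_lt_zero hc
  filter_upwards [ho.mem_nhds hU] with V hV
  rw [dirac_apply_of_mem hV, ← dirac_apply_of_mem hU]
  exact hc

/-- For each point `x`, the preimage of `{W | x ∈ W}` is everything, itself or empty. This serves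
both constrictions and, with `V = ⊥`, restrictions. -/
theorem continuous_pointwise_inf_sup (U V : Opens X) :
    @Continuous _ _ (pointwiseTopology X) (pointwiseTopology X) fun W : Opens X => W ⊓ U ⊔ V := by
  let _ := pointwiseTopology X
  refine continuous_generateFrom_iff.2 ?_
  rintro _ ⟨x, rfl⟩
  have ho : IsOpen {U : Opens X | x ∈ U} := isOpen_generateFrom_of_mem ⟨x, rfl⟩
  by_cases hV : x ∈ V
  · convert isOpen_univ using 1
    ext W
    simp [hV]
  by_cases hU : x ∈ U
  · convert ho using 1
    ext W
    simp [hV, hU]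
  · convert isOpen_empty using 1
    ext W
    simp [hV, hU]

variable (X) in
/-- The cone of bounded valuations. -/
noncomputable def boundedCone : Submodule ℝ≥0 (ContinuousValuation X) where
  carrier := bounded X
  add_mem' hμ hν := ENNReal.add_lt_top.2 ⟨hμ, hν⟩
  zero_mem' := ENNReal.zero_lt_top
  smul_mem' c _ hν := IsBounded.smul hν c

variable (X) in
/-- The cone of point-continuous valuations. -/
noncomputable def pointContinuousCone : Submodule ℝ≥0 (ContinuousValuation X) where
  carrier := pointContinuous X
  add_mem' hμ hν := by
    let _ := pointwiseTopology X
    exact isPointContinuous_iff.2 ((isPointContinuous_iff.1 hμ).add (isPointContinuous_iff.1 hν))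
  zero_mem' := by
    let _ := pointwiseTopology X
    exact isPointContinuous_iff.2 lowerSemicontinuous_const
  smul_mem' c ν hν := by
    let _ := pointwiseTopology X
    exact isPointContinuous_iff.2 (LowerSemicontinuous.ennreal_mul
      (lowerSemicontinuous_const (z := (c : ℝ≥0∞))) (isPointContinuous_iff.1 hν))

variable (X) in
/-- The cone of simple valuations. -/
noncomputable def simpleCone : Submodule ℝ≥0 (ContinuousValuation X) :=
  Submodule.span ℝ≥0 (range dirac)

theorem coe_simpleCone : (simpleCone X : Set (ContinuousValuation X)) = simple X := by
  ext ν
  rw [SetLike.mem_coe, simpleCone, Submodule.mem_span_set']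
  constructor
  · rintro ⟨n, a, g, rfl⟩
    choose x hx using fun i => (g i).2
    exact ⟨n, a, x, by simp only [hx]⟩
  · rintro ⟨n, a, x, rfl⟩
    exact ⟨n, a, fun i => ⟨dirac (x i), mem_range_self _⟩, rfl⟩

theorem dirac_mem_simpleCone (x : X) : dirac x ∈ simpleCone X :=
  Submodule.subset_span (mem_range_self x)

theorem simpleCone_le_boundedCone : simpleCone X ≤ boundedCone X := by
  refine Submodule.span_le.2 ?_
  rintro _ ⟨x, rfl⟩
  exact (dirac_apply_of_mem (Opens.mem_top x)).trans_lt ENNReal.one_lt_top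

theorem constrictionClosed_top :
    ConstrictionClosed (⊤ : Submodule ℝ≥0 (ContinuousValuation X)) :=
  fun _ _ _ _ _ => Submodule.mem_top

theorem constrictionClosed_boundedCone : ConstrictionClosed (boundedCone X) :=
  fun _ _ hν _ _ => (crescentMass_ne_top hν _ _).lt_top

/-- Subtracting the finite constant `ν V` preserves lower semicontinuity. -/
theorem constrictionClosed_pointContinuousCone : ConstrictionClosed (pointContinuousCone X) := by
  intro ν hνS hν U V
  let _ := pointwiseTopology X
  refine isPointContinuous_iff.2 fun W c hc => ?_
  have h := LowerSemicontinuous.comp (isPointContinuous_iff.1 hνS)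
    (continuous_pointwise_inf_sup U V)
  filter_upwards [h W (c + ν V) (lt_tsub_iff_right.1 hc)] with W' hW'
  exact lt_tsub_iff_right.2 hW'

theorem constrictionClosed_simpleCone : ConstrictionClosed (simpleCone X) := by
  classical
  intro ν hνS hν U V
  obtain ⟨n, a, x, rfl⟩ : ν ∈ simple X := by
    rwa [← coe_simpleCone]
  -- Constriction keeps exactly the point masses located in the crescent.
  have e : (∑ i, a i • dirac (x i)).constriction hν U V =
      ∑ i, (if x i ∈ U ∧ x i ∉ V then a i else 0) • dirac (x i) := by
    refine DFunLike.ext _ _ fun W => ?_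
    refine ENNReal.sub_eq_of_eq_add (hν.ne_top V) ?_
    simp only [sum_apply, smul_apply]
    rw [← Finset.sum_add_distrib]
    refine Finset.sum_congr rfl fun i _ => ?_
    by_cases hV : x i ∈ V
    · rw [dirac_apply_of_mem hV, dirac_apply_of_mem (Or.inr hV)]
      simp [hV]
    by_cases hU : x i ∈ U
    · by_cases hW : x i ∈ W
      · rw [dirac_apply_of_mem hW, dirac_apply_of_mem (Or.inl ⟨hW, hU⟩), dirac_apply_of_notMem hV]
        simp [hV, hU]
      · rw [dirac_apply_of_notMem hW, dirac_apply_of_notMem hV, dirac_apply_of_notMem]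
        · simp
        · rintro (h | h)
          exacts [hW h.1, hV h]
    · rw [dirac_apply_of_notMem hV, dirac_apply_of_notMem]
      · simp [hU]
      · rintro (h | h)
        exacts [hU h.2, hV h]
  rw [e]
  exact sum_mem fun i _ => Submodule.smul_mem _ _ (dirac_mem_simpleCone _)

/-- A cone that contains the simple valuations and the restrictions of its elements to open sets
has enough bounded elements. -/
theorem exists_directed_of_restrict_mem {S : Submodule ℝ≥0 (ContinuousValuation X)}
    (hdirac : ∀ x, dirac x ∈ S) (hrestrict : ∀ ν ∈ S, ∀ U, ν.restrict U ∈ S) :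
    ∀ ν ∈ S, ∃ D : Set (ContinuousValuation X),
      D ⊆ S ∩ bounded X ∧ D.Nonempty ∧ DirectedOn (· ≤ ·) D ∧ IsLUB D ν := by
  intro ν hν
  obtain ⟨D, hne, hD, hlub, h⟩ := ν.exists_directed_approximation
  refine ⟨D, fun μ hμ => ?_, hne, hD, hlub⟩
  obtain ⟨U, A, n, hU, rfl⟩ := h μ hμ
  refine ⟨S.add_mem (hrestrict ν hν U) (sum_mem fun x _ => S.smul_mem _ (hdirac x)),
    (boundedCone X).add_mem ?_ (sum_mem fun x _ => (boundedCone X).smul_mem _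
      (simpleCone_le_boundedCone (dirac_mem_simpleCone x)))⟩
  exact (ν.mono inf_le_right).trans_lt hU

theorem restrict_mem_pointContinuousCone {ν : ContinuousValuation X}
    (hν : ν ∈ pointContinuousCone X) (U : Opens X) : ν.restrict U ∈ pointContinuousCone X := by
  let _ := pointwiseTopology X
  refine isPointContinuous_iff.2 ?_
  have h := (isPointContinuous_iff.1 hν).comp (continuous_pointwise_inf_sup U ⊥)
  simp only [sup_bot_eq] at h
  exact h

theorem combinationsOpenIn_univ : CombinationsOpenIn (univ : Set (ContinuousValuation X)) :=
  constrictionClosed_top.combinationsOpenIn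
    (exists_directed_of_restrict_mem (fun _ => Submodule.mem_top) fun _ _ _ => Submodule.mem_top)

end ContinuousValuation

/-! ### The criterion and its particular cases -/

theorem mainTheorem10 {X : Type*} [TopologicalSpace X] :
    -- the general criterion
    (∀ B : Set (ContinuousValuation X), Convex ℝ≥0 B →
      (∀ ν ∈ B, ∃ D : Set (ContinuousValuation X),
        D ⊆ B ∩ ContinuousValuation.bounded X ∧ D.Nonempty ∧ DirectedOn (· ≤ ·) D ∧ IsLUB D ν) →
      (∀ μ ∈ B ∩ ContinuousValuation.bounded X, ∀ c : ℝ≥0, 0 < c → c < 1 → c • μ ∈ B) →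
      (∀ μ ∈ B ∩ ContinuousValuation.bounded X, ∀ ϖ ∈ B, ∀ hϖ : ϖ.IsBounded, ∀ r : ℝ≥0, 1 < r →
        ∀ μ' : ContinuousValuation X, μ'.IsCrescentCombination (r • ϖ) (hϖ.smul r) →
          μ ⊤ = μ' ⊤ → μ' ∈ B) →
      IsStronglyConsistentTopologicalSubalgebra B) ∧
    -- consistent topological cones
    (IsConsistentTopologicalCone (ContinuousValuation X) ∧
      IsConsistentTopologicalSubcone (ContinuousValuation.bounded X) ∧
      IsConsistentTopologicalSubcone (ContinuousValuation.pointContinuous X) ∧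
      IsConsistentTopologicalSubcone (ContinuousValuation.simple X)) ∧
    -- subprobability valuations
    (IsStronglyConsistentTopologicalSubalgebra (ContinuousValuation.subprobability X) ∧
      IsStronglyConsistentTopologicalSubalgebra
        (ContinuousValuation.subprobability X ∩ ContinuousValuation.pointContinuous X) ∧
      IsStronglyConsistentTopologicalSubalgebra
        (ContinuousValuation.subprobability X ∩ ContinuousValuation.simple X)) ∧
    -- probability valuations on a space with a least element in the specialization preordering
    ((∃ bot : X, ∀ x : X, x ⤳ bot) →
      IsStronglyConsistentTopologicalSubalgebra (ContinuousValuation.probability X) ∧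
      IsStronglyConsistentTopologicalSubalgebra
        (ContinuousValuation.probability X ∩ ContinuousValuation.pointContinuous X) ∧
      IsStronglyConsistentTopologicalSubalgebra
        (ContinuousValuation.probability X ∩ ContinuousValuation.simple X)) := by
  refine ⟨fun B hB hsup hsmul hcomb =>
      (ContinuousValuation.combinationsOpenIn_of_crescentCombination hsup hsmul
        hcomb).isStronglyConsistentTopologicalSubalgebra hB,
    ⟨ContinuousValuation.combinationsOpenIn_univ.isConsistentTopologicalCone, ?_, ?_, ?_⟩,
    ?_, ?_⟩
  · exact ContinuousValuation.CombinationsOpenIn.isConsistentTopologicalSubcone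
      (ContinuousValuation.boundedCone X)
      (ContinuousValuation.constrictionClosed_boundedCone.combinationsOpenIn
        fun ν hν => ContinuousValuation.exists_directed_of_isBounded hν hν)
  · exact ContinuousValuation.CombinationsOpenIn.isConsistentTopologicalSubcone
      (ContinuousValuation.pointContinuousCone X)
      (ContinuousValuation.constrictionClosed_pointContinuousCone.combinationsOpenIn
        (ContinuousValuation.exists_directed_of_restrict_mem
          ContinuousValuation.isPointContinuous_dirac
          fun _ => ContinuousValuation.restrict_mem_pointContinuousCone))
  · rw [← ContinuousValuation.coe_simpleCone]
    exact ContinuousValuation.CombinationsOpenIn.isConsistentTopologicalSubcone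
      (ContinuousValuation.simpleCone X)
      (ContinuousValuation.constrictionClosed_simpleCone.combinationsOpenIn
        fun ν hν => ContinuousValuation.exists_directed_of_isBounded hν
          (ContinuousValuation.simpleCone_le_boundedCone hν))
  · have key : ∀ {S : Submodule ℝ≥0 (ContinuousValuation X)},
        ContinuousValuation.ConstrictionClosed S →
        IsStronglyConsistentTopologicalSubalgebra (ContinuousValuation.subprobability X ∩ S) :=
      fun {S} hS => hS.combinationsOpenIn_subprobability.isStronglyConsistentTopologicalSubalgebra
        (ContinuousValuation.convex_subprobability.inter S.convex)
    refine ⟨?_, key ContinuousValuation.constrictionClosed_pointContinuousCone, ?_⟩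
    · simpa using key ContinuousValuation.constrictionClosed_top
    · rw [← ContinuousValuation.coe_simpleCone]
      exact key ContinuousValuation.constrictionClosed_simpleCone
  · rintro ⟨bot, hbot⟩
    have key : ∀ {S : Submodule ℝ≥0 (ContinuousValuation X)},
        ContinuousValuation.ConstrictionClosed S → ContinuousValuation.dirac bot ∈ S →
        IsStronglyConsistentTopologicalSubalgebra (ContinuousValuation.probability X ∩ S) :=
      fun {S} hS hd => (hS.combinationsOpenIn_subprobability.probability hbot
        hd).isStronglyConsistentTopologicalSubalgebra
        (ContinuousValuation.convex_probability.inter S.convex)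
    refine ⟨?_, key ContinuousValuation.constrictionClosed_pointContinuousCone
      (ContinuousValuation.isPointContinuous_dirac bot), ?_⟩
    · simpa using key ContinuousValuation.constrictionClosed_top Submodule.mem_top
    · rw [← ContinuousValuation.coe_simpleCone]
      exact key ContinuousValuation.constrictionClosed_simpleCone
        (ContinuousValuation.dirac_mem_simpleCone bot)
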